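/- **Setting.** Let $\mathfrak g$ be a real semisimple Lie algebra (a complex one is regarded as a real one). Fix a Cartan involution, a maximal abelian subspace $\mathfrak a$ of its $(-1)$-eigenspace, a system of simple restricted roots, and subsets $\Sigma_{\mathfrak p}\subset\Sigma_{\mathfrak q}$ of it. For a set $\Sigma$ of simple restricted roots, the $\Sigma$-height of a restricted root is the sum of the coefficients of the elements of $\Sigma$ in its expansion; the centralizer of $\mathfrak a$ has height $0$. Let $\mathfrak q\subset\mathfrak p\subset\mathfrak g$ be the standard parabolic subalgebras for $\Sigma_{\mathfrak q}$ and $\Sigma_{\mathfrak p}$, i.e. the sums of all restricted root spaces of non-negative height. Let $\mathfrak g_{(i',i'')}$ be the sum of the restricted root spaces of $\Sigma_{\mathfrak p}$-height $i'$ and $\Sigma_{\mathfrak q}$-height $i'+i''$, and put $\mathfrak g^{(i',*)}=\bigoplus_{j'\ge i',\,j''}\mathfrak g_{(j',j'')}$, so $\mathfrak g^{(0,*)}=\mathfrak p$. Let $G$ be a Lie group with Lie algebra $\mathfrak g$, let $P\subset G$ be a subgroup lying between $N_G(\mathfrak p)$ and its identity component, and let $Q\subset P$ be a Lie subgroup with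 Lie algebra $\mathfrak q$ lying between $N_P(\mathfrak q)$ and its identity component. Let $(\pi\colon\mathcal G\to M,\omega)$ be a Cartan geometry of type $(G,Q)$, i.e. a smooth principal $Q$-bundle with a Cartan connection $\omega\in\Omega^1(\mathcal G,\mathfrak g)$. Then $TM\cong\mathcal G\times_Q(\mathfrak g/\mathfrak q)$. Let $T_\rho M=T^0_PM$ and, for $i'<0$, $T^{i'}_PM$ be the subbundles of $TM$ corresponding to $\mathfrak p/\mathfrak q$ and $\mathfrak g^{(i',*)}/\mathfrak q$, and let $\mathcal V_{i'}M=T^{i'}_PM/T^{i'+1}_PM\cong\mathcal G\times_Q\bigl(\mathfrak g^{(i',*)}/\mathfrak g^{(i'+1,*)}\bigr)$. Let $\tau\in\Omega^2(M,TM)$ be the torsion of $\omega$, i.e. the projection to $TM$ of the curvature $d\omega+\frac12[\omega,\omega]$. The relative tractor connection on $\mathcal V_{i'}M$ is the partial connection $\nabla^{\rho}_{\xi}\sigma=D_s\sigma+s\bullet\sigma$ for $\xi\in\Gamma(T_\rho M)$. Here $s$ is any lift of $\xi$ to $\mathcal G\times_Q\mathfrak p$. Viewing sections as $Q$-equivariant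 functions on $\mathcal G$, $D_s\sigma$ is the derivative of $\sigma$ along the vector field $\omega^{-1}(s)$ on $\mathcal G$, and $\bullet$ is induced by the adjoint action of $\mathfrak p$ on $\mathfrak g^{(i',*)}/\mathfrak g^{(i'+1,*)}$. **Theorem.** Let $i'<0$, let $\xi\in\Gamma(T_\rho M)$ and $\eta\in\Gamma(T^{i'}_PM)$ be smooth vector fields, and let $\sigma\in\Gamma(\mathcal V_{i'}M)$. 1. The vector field $[\xi,\eta]+\tau(\xi,\eta)$ is a smooth section of $T^{i'}_PM$. 2. If $\eta$ is a representative for $\sigma$, then the projection of $[\xi,\eta]+\tau(\xi,\eta)$ to $\Gamma(\mathcal V_{i'}M)$ depends only on $\sigma$ (and not on the choice of $\eta$) and coincides with $\nabla^{\rho}_\xi\sigma$ (whichever lift of $\xi$ is used to compute the latter). -/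

import Mathlib

open scoped Manifold ContDiff
open VectorField

namespace RelativeTractor

noncomputable section

/-! ### Nested standard parabolic subalgebras and the bigrading -/

section Algebra

variable {L : Type*} [LieRing L] [LieAlgebra ℝ L]

/-- The simultaneous eigenspace of `ad H`, `H ∈ 𝔞`, for the linear functional `χ` on `𝔞`. -/
def restrictedRootSpace (𝔞 : Submodule ℝ L) (χ : Module.Dual ℝ 𝔞) : Submodule ℝ L where
  carrier := {X | ∀ H : 𝔞, ⁅(H : L), X⁆ = χ H • X}
  add_mem' := by
    intro X Y hX hY H
    rw [lie_add, hX H, hY H, smul_add]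
  zero_mem' := by
    intro H
    simp
  smul_mem' := by
    intro c X hX H
    rw [lie_smul, hX H, smul_comm]

/-- Restricted roots: the nonzero functionals with nonzero eigenspace. -/
def IsRestrictedRoot (𝔞 : Submodule ℝ L) (χ : Module.Dual ℝ 𝔞) : Prop :=
  χ ≠ 0 ∧ restrictedRootSpace 𝔞 χ ≠ ⊥

variable (L) in
/-- The data fixing two nested standard parabolic subalgebras `𝔮 ⊆ 𝔭` of a real semisimple Lie
algebra: a Cartan involution `θ`, a maximal abelian subspace `𝔞` of its `(-1)`-eigenspace, a system
of simple restricted roots, and two subsets `Sp ⊆ Sq` of simple restricted roots. -/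
structure NestedParabolicData where
  /-- The Cartan involution. -/
  θ : L ≃ₗ⁅ℝ⁆ L
  θ_involutive : ∀ X, θ (θ X) = X
  θ_cartan : ∀ X, X ≠ 0 → killingForm ℝ L X (θ X) < 0
  /-- The maximal abelian subspace. -/
  𝔞 : Submodule ℝ L
  𝔞_anti : ∀ X ∈ 𝔞, θ X = -X
  𝔞_abelian : ∀ X ∈ 𝔞, ∀ Y ∈ 𝔞, ⁅X, Y⁆ = 0
  𝔞_maximal : ∀ X, θ X = -X → (∀ Y ∈ 𝔞, ⁅X, Y⁆ = 0) → X ∈ 𝔞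
  /-- The number of simple restricted roots. -/
  rank : ℕ
  /-- The simple restricted roots. -/
  simple : Module.Basis (Fin rank) ℝ (Module.Dual ℝ 𝔞)
  simple_isRoot : ∀ i, IsRestrictedRoot 𝔞 (simple i)
  root_pos_or_neg : ∀ χ, IsRestrictedRoot 𝔞 χ →
    (∀ i, ∃ n : ℕ, simple.repr χ i = n) ∨ (∀ i, ∃ n : ℕ, simple.repr χ i = -(n : ℝ))
  /-- The subset of simple restricted roots determining `𝔭`. -/
  Sp : Finset (Fin rank)
  /-- The subset of simple restricted roots determining `𝔮`. -/
  Sq : Finset (Fin rank)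
  Sp_subset_Sq : Sp ⊆ Sq

namespace NestedParabolicData

variable (D : NestedParabolicData L)

/-- The `S`-height: the sum of the coefficients of the simple roots belonging to `S`. -/
def height (S : Finset (Fin D.rank)) (χ : Module.Dual ℝ D.𝔞) : ℝ :=
  ∑ i ∈ S, D.simple.repr χ i

/-- The standard parabolic subalgebra given by a set `S` of simple restricted roots: the sum of the
eigenspaces of nonnegative `S`-height (including the centralizer of `𝔞`, the eigenspace of `0`). -/
def standardParabolic (S : Finset (Fin D.rank)) : Submodule ℝ L :=
  ⨆ (χ : Module.Dual ℝ D.𝔞) (_ : 0 ≤ D.height S χ), restrictedRootSpace D.𝔞 χ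

/-- The parabolic subalgebra `𝔭`. -/
def pAlg : Submodule ℝ L := D.standardParabolic D.Sp

/-- The parabolic subalgebra `𝔮`. -/
def qAlg : Submodule ℝ L := D.standardParabolic D.Sq

/-- The component `𝔤_(i',i'')` of the bigrading. -/
def bigraded (i j : ℤ) : Submodule ℝ L :=
  ⨆ (χ : Module.Dual ℝ D.𝔞) (_ : D.height D.Sp χ = i ∧ D.height D.Sq χ = i + j),
    restrictedRootSpace D.𝔞 χ

/-- The filtration component `𝔤^(i',*)`, the sum of all `𝔤_(j',j'')` with `j' ≥ i'`. -/
def filt (i : ℤ) : Submodule ℝ L :=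
  ⨆ (i' : ℤ) (_ : i ≤ i') (j : ℤ), D.bigraded i' j

lemma exists_int_height (S : Finset (Fin D.rank)) {χ : Module.Dual ℝ D.𝔞}
    (h : restrictedRootSpace D.𝔞 χ ≠ ⊥) : ∃ n : ℤ, D.height S χ = n := by
  classical
  have key : ∀ i, ∃ n : ℤ, D.simple.repr χ i = n := by
    intro i
    by_cases h0 : χ = 0
    · exact ⟨0, by simp [h0]⟩
    · rcases D.root_pos_or_neg χ ⟨h0, h⟩ with h1 | h1
      · obtain ⟨n, hn⟩ := h1 i
        exact ⟨n, by simp [hn]⟩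
      · obtain ⟨n, hn⟩ := h1 i
        exact ⟨-n, by simp [hn]⟩
  choose n hn using key
  exact ⟨∑ i ∈ S, n i, by simp [height, hn]⟩

lemma filt_eq (i : ℤ) : D.filt i =
    ⨆ (χ : Module.Dual ℝ D.𝔞) (_ : (i : ℝ) ≤ D.height D.Sp χ), restrictedRootSpace D.𝔞 χ := by
  apply le_antisymm
  · refine iSup_le fun i' => iSup_le fun hi' => iSup_le fun j => iSup_le fun χ => iSup_le fun h => ?_
    refine le_iSup_of_le χ (le_iSup_of_le ?_ le_rfl)
    rw [h.1]
    exact_mod_cast hi'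
  · refine iSup_le fun χ => iSup_le fun h => ?_
    by_cases hb : restrictedRootSpace D.𝔞 χ = ⊥
    · rw [hb]
      exact bot_le
    · obtain ⟨n, hn⟩ := D.exists_int_height D.Sp hb
      obtain ⟨m, hm⟩ := D.exists_int_height D.Sq hb
      refine le_iSup_of_le n (le_iSup_of_le ?_ (le_iSup_of_le (m - n)
        (le_iSup_of_le χ (le_iSup_of_le ⟨hn, ?_⟩ le_rfl))))
      · rw [hn] at h
        exact_mod_cast h
      · rw [hm]
        push_cast
        ring

/-- `𝔤^(0,*) = 𝔭`. -/
lemma filt_zero : D.filt 0 = D.pAlg := by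
  rw [filt_eq]
  simp [pAlg, standardParabolic]

lemma filt_anti {i j : ℤ} (h : i ≤ j) : D.filt j ≤ D.filt i :=
  iSup_le fun i' => iSup_le fun hi' =>
    le_iSup_of_le i' (le_iSup_of_le (h.trans hi') le_rfl)

lemma lie_mem_rootSpace {χ ψ : Module.Dual ℝ D.𝔞} {X Y : L}
    (hX : X ∈ restrictedRootSpace D.𝔞 χ) (hY : Y ∈ restrictedRootSpace D.𝔞 ψ) :
    ⁅X, Y⁆ ∈ restrictedRootSpace D.𝔞 (χ + ψ) := by
  intro H
  rw [leibniz_lie, hX H, hY H, smul_lie, lie_smul, LinearMap.add_apply, add_smul]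

lemma lie_mem_filt {i j : ℤ} {X Y : L} (hX : X ∈ D.filt i) (hY : Y ∈ D.filt j) :
    ⁅X, Y⁆ ∈ D.filt (i + j) := by
  rw [filt_eq] at hX hY ⊢
  induction hX using Submodule.iSup_induction' with
  | zero => simp
  | add X X' _ _ h h' => rw [add_lie]; exact Submodule.add_mem _ h h'
  | mem χ X hX =>
    by_cases hχ : (i : ℝ) ≤ D.height D.Sp χ
    swap
    · simp [hχ] at hX
      simp [hX]
    simp only [hχ, iSup_pos] at hX
    induction hY using Submodule.iSup_induction' with
    | zero => simp
    | add Y Y' _ _ h h' => rw [lie_add]; exact Submodule.add_mem _ h h'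
    | mem ψ Y hY =>
      by_cases hψ : (j : ℝ) ≤ D.height D.Sp ψ
      swap
      · simp [hψ] at hY
        simp [hY]
      simp only [hψ, iSup_pos] at hY
      refine Submodule.mem_iSup_of_mem (χ + ψ) (Submodule.mem_iSup_of_mem ?_
        (D.lie_mem_rootSpace hX hY))
      have : D.height D.Sp (χ + ψ) = D.height D.Sp χ + D.height D.Sp ψ := by
        simp [height, Finset.sum_add_distrib]
      rw [this]
      push_cast
      linarith

lemma lie_pAlg_filt {i : ℤ} {X Y : L} (hX : X ∈ D.pAlg) (hY : Y ∈ D.filt i) :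
    ⁅X, Y⁆ ∈ D.filt i := by
  rw [← filt_zero] at hX
  simpa using D.lie_mem_filt hX hY

/-- The `P`-representation `𝕍_{i'} = 𝔤^(i',*) / 𝔤^(i'+1,*)`. -/
abbrev VRep (i : ℤ) : Type _ := ↥(D.filt i) ⧸ (D.filt (i + 1)).submoduleOf (D.filt i)

/-- The infinitesimal representation of `𝔭` on `𝕍_{i'}`, induced by the adjoint representation:
`A • [X] = [⁅A, X⁆]`. -/
def bullet (i : ℤ) (A : D.pAlg) : D.VRep i →ₗ[ℝ] D.VRep i :=
  Submodule.mapQ _ _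
    ((LieAlgebra.ad ℝ L (A : L) : L →ₗ[ℝ] L).restrict
      (p := D.filt i) (q := D.filt i) fun _ hY => D.lie_pAlg_filt A.2 hY)
    (fun _ hY => D.lie_pAlg_filt A.2 hY)

end NestedParabolicData

end Algebra

/-! ### The group level -/

section Group

variable {nG : ℕ} {G : Type*} [TopologicalSpace G] [ChartedSpace (EuclideanSpace ℝ (Fin nG)) G]
  [Group G]

/-- The adjoint representation `Ad(g)`: the derivative at `1` of conjugation by `g`. -/
def Ad (g : G) : GroupLieAlgebra (𝓡 nG) G →L[ℝ] GroupLieAlgebra (𝓡 nG) G :=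
  mfderiv (𝓡 nG) (𝓡 nG) (fun x : G => g * x * g⁻¹) 1

/-- The normalizer `N_G(W)` of a linear subspace `W` of the Lie algebra. -/
def normalizer (W : Submodule ℝ (GroupLieAlgebra (𝓡 nG) G)) : Set G :=
  {g | W.map (Ad (nG := nG) g).toLinearMap = W}

instance : ENat.LEInfty (minSmoothness ℝ 3) :=
  by rw [minSmoothness_of_isRCLikeNormedField]; infer_instance

variable [LieGroup (𝓡 nG) ∞ G]

instance : Module.Finite ℝ (GroupLieAlgebra (𝓡 nG) G) :=
  inferInstanceAs (Module.Finite ℝ (EuclideanSpace ℝ (Fin nG)))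

/-- `P` is a parabolic subgroup of `G` corresponding to `𝔭`: it lies between `N_G(𝔭)` and its
identity component. -/
def IsParabolicSubgroup (D : NestedParabolicData (GroupLieAlgebra (𝓡 nG) G)) (P : Subgroup G) :
    Prop :=
  connectedComponentIn (normalizer D.pAlg) 1 ⊆ (P : Set G) ∧ (P : Set G) ⊆ normalizer D.pAlg

/-- `Q` is a subgroup of `P` corresponding to `𝔮`: it lies between `N_P(𝔮)` and its identity
component, and (with its given manifold structure) it is an embedded Lie subgroup of `G` with Lie
algebra `𝔮`. -/
structure IsNestedParabolicSubgroup (D : NestedParabolicData (GroupLieAlgebra (𝓡 nG) G))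
    (P : Subgroup G) {nQ : ℕ} (Q : Subgroup G) [ChartedSpace (EuclideanSpace ℝ (Fin nQ)) Q] :
    Prop where
  component_subset : connectedComponentIn (normalizer D.qAlg ∩ P) 1 ⊆ (Q : Set G)
  subset_normalizer : (Q : Set G) ⊆ normalizer D.qAlg ∩ P
  contMDiff_coe : ContMDiff (𝓡 nQ) (𝓡 nG) ∞ (fun q : Q => (q : G))
  immersive : ∀ q : Q, Function.Injective (mfderiv (𝓡 nQ) (𝓡 nG) (fun q : Q => (q : G)) q)
  range_eq : Set.range (mfderiv (𝓡 nQ) (𝓡 nG) (fun q : Q => (q : G)) 1) =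
    (D.qAlg : Set (GroupLieAlgebra (𝓡 nG) G))

end Group

/-! ### Cartan geometries -/

/-- The derivative at `u` in the direction `X` of a function with values in a finite dimensional
real vector space, computed in linear coordinates on that space. -/
def dirDeriv {n : ℕ} {B : Type*} [TopologicalSpace B] [ChartedSpace (EuclideanSpace ℝ (Fin n)) B]
    {V : Type*} [AddCommGroup V] [Module ℝ V] [Module.Finite ℝ V]
    (f : B → V) (u : B) (X : TangentSpace (𝓡 n) u) : V :=
  ∑ k, NormedSpace.fromTangentSpace _
    (mfderiv (𝓡 n) 𝓘(ℝ, ℝ) (fun v => (Module.finBasis ℝ V).repr (f v) k) u X) •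
    Module.finBasis ℝ V k

/-- A Cartan geometry of type `(G, Q)` on `M` with total space `B`: a smooth principal (right)
`Q`-bundle `proj : B → M` together with a Cartan connection `form` (denoted `ω` in comments). -/
structure CartanGeometry {nG nQ nM nB : ℕ}
    {G : Type*} [TopologicalSpace G] [ChartedSpace (EuclideanSpace ℝ (Fin nG)) G] [Group G]
    (Q : Subgroup G) [ChartedSpace (EuclideanSpace ℝ (Fin nQ)) Q]
    (M : Type*) [TopologicalSpace M] [ChartedSpace (EuclideanSpace ℝ (Fin nM)) M]
    (B : Type*) [TopologicalSpace B] [ChartedSpace (EuclideanSpace ℝ (Fin nB)) B]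
    [IsManifold (𝓡 nB) ∞ B] where
  /-- The bundle projection. -/
  proj : B → M
  contMDiff_proj : ContMDiff (𝓡 nB) (𝓡 nM) ∞ proj
  /-- The principal right action `(u, q) ↦ u · q`. -/
  act : B → Q → B
  act_one : ∀ u, act u 1 = u
  act_mul : ∀ u q r, act u (q * r) = act (act u q) r
  contMDiff_act : ContMDiff ((𝓡 nB).prod (𝓡 nQ)) (𝓡 nB) ∞ (fun z : B × Q => act z.1 z.2)
  proj_act : ∀ u q, proj (act u q) = proj u
  locally_trivial : ∀ x : M, ∃ U : Set M, IsOpen U ∧ x ∈ U ∧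
    ∃ e : PartialDiffeomorph (𝓡 nB) ((𝓡 nM).prod (𝓡 nQ)) B (M × Q) ∞,
      e.source = proj ⁻¹' U ∧ e.target = U ×ˢ Set.univ ∧
      ∀ u ∈ e.source, (e u).1 = proj u ∧ ∀ q, (e (act u q)).2 = (e u).2 * q
  /-- The Cartan connection, trivializing the tangent bundle of `B`. -/
  form : ∀ u : B, TangentSpace (𝓡 nB) u ≃L[ℝ] GroupLieAlgebra (𝓡 nG) G
  contMDiff_form : ∀ ℓ : Module.Dual ℝ (GroupLieAlgebra (𝓡 nG) G),
    ContMDiff (𝓡 nB).tangent 𝓘(ℝ, ℝ) ∞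
      (fun X : TangentBundle (𝓡 nB) B => ℓ (form X.proj X.snd))
  form_equivariant : ∀ (u : B) (q : Q) (X : TangentSpace (𝓡 nB) u),
    form (act u q) (mfderiv (𝓡 nB) (𝓡 nB) (fun v => act v q) u X) = Ad ((q : G)⁻¹) (form u X)
  /-- `ω` reproduces the generators of fundamental vector fields. -/
  form_fundamental : ∀ (u : B) (a : TangentSpace (𝓡 nQ) (1 : Q)),
    form (act u 1) (mfderiv (𝓡 nQ) (𝓡 nB) (fun q => act u q) 1 a) =
      mfderiv (𝓡 nQ) (𝓡 nG) (fun q : Q => (q : G)) 1 a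

namespace CartanGeometry

variable {nG nQ nM nB : ℕ}
    {G : Type*} [TopologicalSpace G] [ChartedSpace (EuclideanSpace ℝ (Fin nG)) G] [Group G]
    {Q : Subgroup G} [ChartedSpace (EuclideanSpace ℝ (Fin nQ)) Q]
    {M : Type*} [TopologicalSpace M] [ChartedSpace (EuclideanSpace ℝ (Fin nM)) M]
    {B : Type*} [TopologicalSpace B] [ChartedSpace (EuclideanSpace ℝ (Fin nB)) B]
    [IsManifold (𝓡 nB) ∞ B]
    (C : CartanGeometry (nG := nG) (nQ := nQ) (nM := nM) (nB := nB) Q M B)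

lemma proj_surjective : Function.Surjective C.proj := by
  intro x
  obtain ⟨U, -, hx, e, hs, ht, he⟩ := C.locally_trivial x
  have hmem : ((x, 1) : M × Q) ∈ e.target := by rw [ht]; exact ⟨hx, trivial⟩
  have h2 := e.toPartialEquiv.map_target hmem
  refine ⟨e.toPartialEquiv.symm (x, 1), ?_⟩
  rw [← (he _ h2).1]
  have := e.toPartialEquiv.right_inv hmem
  exact congrArg Prod.fst this

/-- A point of `B` over `x`, used to evaluate objects that are independent of this choice. -/
def pt (x : M) : B := (C.proj_surjective x).choose

lemma proj_pt (x : M) : C.proj (C.pt x) = x := (C.proj_surjective x).choose_spec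

/-- The map `𝔤 → T_xM`, `x = proj u`, given by `A ↦ T_u proj (ω_u⁻¹ A)`; it induces the isomorphism
`B ×_Q (𝔤/𝔮) ≅ TM`, and is the fibre of the projection `Π : 𝒜M → TM` in the frame `u`. -/
def toTangent (u : B) : GroupLieAlgebra (𝓡 nG) G →ₗ[ℝ] TangentSpace (𝓡 nM) (C.proj u) :=
  (mfderiv (𝓡 nB) (𝓡 nM) C.proj u : TangentSpace (𝓡 nB) u →ₗ[ℝ] TangentSpace (𝓡 nM) (C.proj u)) ∘ₗ
    ((C.form u).symm : GroupLieAlgebra (𝓡 nG) G →ₗ[ℝ] TangentSpace (𝓡 nB) u)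

/-- The curvature function: `κ(u)(A, B) = ⁅A, B⁆ - ω_u [ω⁻¹ A, ω⁻¹ B](u)`, that is,
the curvature form `dω + [ω, ω]` evaluated on the vector fields `ω⁻¹ A`, `ω⁻¹ B` on which `ω` is
constant. -/
def curvature (u : B) (A A' : GroupLieAlgebra (𝓡 nG) G) : GroupLieAlgebra (𝓡 nG) G :=
  ⁅A, A'⁆ - C.form u (mlieBracket (𝓡 nB) (fun v => (C.form v).symm A) (fun v => (C.form v).symm A') u)

/-- The torsion in the frame `u`: lift both tangent vectors, apply the curvature, and project. It
does not depend on the lifts since the curvature is horizontal. -/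
def torsionAt (u : B) (v w : TangentSpace (𝓡 nM) (C.proj u)) : TangentSpace (𝓡 nM) (C.proj u) :=
  C.toTangent u (C.curvature u (Classical.epsilon fun A => C.toTangent u A = v)
    (Classical.epsilon fun A => C.toTangent u A = w))

/-- The torsion `τ` as a two-form on `M` with values in `TM`. -/
def torsion (x : M) :
    TangentSpace (𝓡 nM) x → TangentSpace (𝓡 nM) x → TangentSpace (𝓡 nM) x :=
  Eq.rec (motive := fun y _ =>
    TangentSpace (𝓡 nM) y → TangentSpace (𝓡 nM) y → TangentSpace (𝓡 nM) y)
    (C.torsionAt (C.pt x)) (C.proj_pt x)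

/-- The natural subbundle of `TM` given by the image in `B ×_Q (𝔤/𝔮) ≅ TM` of a subspace `W`. (For
`Q`-invariant `W` all frames over `x` give the same subspace of `T_xM`.) -/
def subbundle (W : Submodule ℝ (GroupLieAlgebra (𝓡 nG) G)) (x : M) :
    Submodule ℝ (TangentSpace (𝓡 nM) x) :=
  ⨆ (u : B) (h : C.proj u = x),
    Eq.rec (motive := fun y _ => Submodule ℝ (TangentSpace (𝓡 nM) y)) (W.map (C.toTangent u)) h

lemma toTangent_mem (W : Submodule ℝ (GroupLieAlgebra (𝓡 nG) G)) (u : B)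
    {A : GroupLieAlgebra (𝓡 nG) G} (hA : A ∈ W) :
    C.toTangent u A ∈ C.subbundle W (C.proj u) :=
  Submodule.mem_iSup_of_mem u (Submodule.mem_iSup_of_mem rfl ⟨A, hA, rfl⟩)

/-- Smooth sections of a family of subspaces of the tangent spaces. -/
structure SmoothSection [IsManifold (𝓡 nM) ∞ M]
    (W : ∀ x : M, Submodule ℝ (TangentSpace (𝓡 nM) x)) where
  /-- The underlying vector field. -/
  toFun : ∀ x : M, TangentSpace (𝓡 nM) x
  contMDiff : ContMDiff (𝓡 nM) (𝓡 nM).tangent ∞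
    (fun x => (⟨x, toFun x⟩ : TangentBundle (𝓡 nM) M))
  mem : ∀ x, toFun x ∈ W x

variable [LieGroup (𝓡 nG) ∞ G] (D : NestedParabolicData (GroupLieAlgebra (𝓡 nG) G))

/-- The relative tangent bundle `T_ρM`, corresponding to `𝔭/𝔮`. -/
def relTangent (x : M) : Submodule ℝ (TangentSpace (𝓡 nM) x) := C.subbundle D.pAlg x

/-- The subbundle `T^{i'}_PM ⊆ TM`, corresponding to `𝔤^(i',*)/𝔮` (for `i' ≤ 0`). -/
def TP (i : ℤ) (x : M) : Submodule ℝ (TangentSpace (𝓡 nM) x) := C.subbundle (D.filt i) x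

/-- `T^0_PM = T_ρM`. -/
lemma TP_zero (x : M) : C.TP D 0 x = C.relTangent D x := by
  rw [TP, relTangent, D.filt_zero]

/-- The fibre at `x` of `𝒱_{i'}M = T^{i'}_PM / T^{i'+1}_PM`. -/
abbrev VBundle (i : ℤ) (x : M) : Type _ :=
  ↥(C.TP D i x) ⧸ (C.TP D (i + 1) x).submoduleOf (C.TP D i x)

/-- The section of `𝒱_{i'}M` represented by a section of `T^{i'}_PM`. -/
def project [IsManifold (𝓡 nM) ∞ M] {i : ℤ} (η : SmoothSection (C.TP D i)) (x : M) :
    C.VBundle D i x :=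
  Submodule.Quotient.mk ⟨η.toFun x, η.mem x⟩

/-- The identification of `𝕍_{i'}` with the fibre of `𝒱_{i'}M` at `proj u` in the frame `u`, i.e. the
isomorphism `B ×_Q 𝕍_{i'} ≅ 𝒱_{i'}M`. -/
def frame (i : ℤ) (u : B) : D.VRep i →ₗ[ℝ] C.VBundle D i (C.proj u) :=
  Submodule.mapQ _ _
    ((C.toTangent u).restrict (p := D.filt i) (q := C.TP D i (C.proj u))
      fun _ hA => C.toTangent_mem (D.filt i) u hA)
    (fun _ hA => C.toTangent_mem (D.filt (i + 1)) u hA)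

/-- The `Q`-equivariant function `B → 𝕍_{i'}` corresponding to a section of `𝒱_{i'}M`
(`frame` is bijective if `i' < 0`). -/
def equivariantFun {i : ℤ} (σ : ∀ x, C.VBundle D i x) (u : B) : D.VRep i :=
  Function.invFun (C.frame D i u) (σ (C.proj u))

/-- `D_s σ + s • σ` at the point `u`, as an element of `𝕍_{i'}`, for `s(u) = A ∈ 𝔭`; here `D` is the
fundamental derivative, `D_s σ (u) = (ω_u⁻¹ A) · σ`. -/
def tractorDeriv {i : ℤ} (σ : ∀ x, C.VBundle D i x) (u : B) (A : D.pAlg) : D.VRep i :=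
  dirDeriv (C.equivariantFun D σ) u ((C.form u).symm (A : GroupLieAlgebra (𝓡 nG) G)) +
    D.bullet i A (C.equivariantFun D σ u)

/-- The relative tractor connection `∇^ρ_ξ σ = D_s σ + s • σ`, where `s` is a lift of `ξ` to
`B ×_Q 𝔭`. At `x` it is evaluated in one frame over `x` and with one lift of `ξ(x)` to `𝔭`; the result
depends on neither. -/
def relTractorConnection {i : ℤ} (ξ : ∀ x : M, TangentSpace (𝓡 nM) x)
    (σ : ∀ x, C.VBundle D i x) (x : M) : C.VBundle D i x :=
  Eq.rec (motive := fun y _ => C.VBundle D i y)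
    (C.frame D i (C.pt x) (C.tractorDeriv D σ (C.pt x)
      (Classical.epsilon fun A : D.pAlg =>
        C.toTangent (C.pt x) (A : GroupLieAlgebra (𝓡 nG) G) = ξ (C.proj (C.pt x)))))
    (C.proj_pt x)

/-- The vector field `[ξ, η] + τ(ξ, η)`. -/
def bracketTorsion (ξ η : ∀ x : M, TangentSpace (𝓡 nM) x) (x : M) : TangentSpace (𝓡 nM) x :=
  mlieBracket (𝓡 nM) ξ η x + C.torsion x (ξ x) (η x)

end CartanGeometry

end

end RelativeTractor

open RelativeTractor

/-!
The theorem is proved by lifting everything to the total space `B` of the Cartan bundle, where the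
Cartan connection `ω` turns vector fields into `𝔤`-valued functions.

If `s` and `t` are local `𝔤`-valued functions such that `ω⁻¹(s)` and `ω⁻¹(t)` project onto `ξ` and
`η`, then `[ω⁻¹(s), ω⁻¹(t)]` projects onto `[ξ, η]`, while the definition of the curvature `κ` gives
`ω([ω⁻¹(s), ω⁻¹(t)]) = D_s t - D_t s + [s, t] - κ(s, t)` (`form_mlieBracket_field`). The torsion is
the projection of `κ(s, t)`, so `[ξ, η] + τ(ξ, η)` is represented by the function
`D_s t - D_t s + [s, t]` (`bracketTorsion_eq`). Here `s` has values in `𝔭` and `t` in the filtration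
component `𝔤^(i',*)`, and hence so have their derivatives. As `i' < 0`, the term `D_t s` disappears
in the quotient `𝔤^(i',*) / 𝔤^(i'+1,*)`, and what remains, `D_s t + [s, t]`, is the relative tractor
connection (`bracketTorsion_tractorDeriv`).

Two kinds of facts make this precise. On the geometric side, the torsion must not depend on the
frame and on the lifts, which means that the curvature is equivariant (`curvature_act`) and
horizontal (`curvature_fundamental`). Horizontality says that the bracket of a fundamental vector
field with `ω⁻¹(A)` is infinitesimally the adjoint action; it follows from `mlieBracket_fundamental`,
which computes such brackets for a general action by relating them to brackets of commuting vector
fields on the product `N × Q`. The same lemma, applied to right multiplication on `G`, identifies the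
derivative of `Ad` with the Lie bracket (`mvfderiv_Ad_apply`).

On the algebraic side, the group `Q` is only known to normalize `𝔭` and `𝔮`, and one needs that it
preserves the whole filtration in nonpositive degrees (`map_filt`). The component `𝔤^(1,*)` is the
annihilator of `𝔭` for the Killing form, and for `j < 0` the component `𝔤^(j,*)` consists of all `Z`
such that `[𝔤^(1,*), Z] ⊆ 𝔤^(j+1,*)` (`mem_filt_of_lie_filt_one`). The latter comes down to the fact
that a root vector for a negative root cannot be annihilated by all simple root spaces
(`eq_zero_of_forall_lie_simple`), which is a positivity argument with the inner product
`-K(X, θ Y)`.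
-/

/-! ### Vector fields, Lie brackets and derivations -/

section
variable {E : Type*} [NormedAddCommGroup E] [NormedSpace ℝ E]
  {H : Type*} [TopologicalSpace H] {I : ModelWithCorners ℝ E H}
  {N : Type*} [TopologicalSpace N] [ChartedSpace H N]
  {F : Type*} [NormedAddCommGroup F] [NormedSpace ℝ F]

open Filter Topology

lemma mvfderiv_comp_mfderiv {E' : Type*} [NormedAddCommGroup E'] [NormedSpace ℝ E']
    {H' : Type*} [TopologicalSpace H'] {I' : ModelWithCorners ℝ E' H'}
    {N' : Type*} [TopologicalSpace N'] [ChartedSpace H' N'] {g : N' → F} {f : N → N'} (x : N)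
    (hg : MDifferentiableAt I' 𝓘(ℝ, F) g (f x)) (hf : MDifferentiableAt I I' f x)
    (v : TangentSpace I x) :
    mvfderiv I (fun y => g (f y)) x v = mvfderiv I' g (f x) (mfderiv I I' f x v) :=
  mfderiv_comp_apply x hg hf v

lemma mvfderiv_eq_fderiv {f : E → F} (x w : E) : mvfderiv 𝓘(ℝ, E) f x w = fderiv ℝ f x w := by
  have h : mfderiv 𝓘(ℝ, E) 𝓘(ℝ, F) f x = fderiv ℝ f x := mfderiv_eq_fderiv
  exact congrArg (fun L : E →L[ℝ] F => L w) h

lemma fderiv_comp_extChartAt_symm [I.Boundaryless] [IsManifold I 1 N] {k : N → F} {x : N} {y : E}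
    (hy : y ∈ (extChartAt I x).target)
    (hk : MDifferentiableAt I 𝓘(ℝ, F) k ((extChartAt I x).symm y)) (w : E) :
    fderiv ℝ (k ∘ (extChartAt I x).symm) y w = mvfderiv I k ((extChartAt I x).symm y)
      (mfderivWithin 𝓘(ℝ, E) I (extChartAt I x).symm (Set.range I) y w) := by
  have h2 := mdifferentiableWithinAt_extChartAt_symm hy
  rw [I.range_eq_univ] at h2 ⊢
  rw [mfderivWithin_univ]
  exact (mvfderiv_eq_fderiv _ _).symm.trans
    (mvfderiv_comp_mfderiv (I := 𝓘(ℝ, E)) y hk (mdifferentiableWithinAt_univ.1 h2) w)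

variable (I) in
/-- The representation of a vector field in the extended chart at `x`, as a map on the model
vector space. -/
noncomputable def chartField (x : N) (V : ∀ y : N, TangentSpace I y) : E → E :=
  mpullbackWithin 𝓘(ℝ, E) I (extChartAt I x).symm V (Set.range I)

/-- A vector field in an extended chart is represented by its pullback, and the derivative along
it of a function can be computed in the chart. -/
lemma fderiv_comp_extChartAt_symm_mpullbackWithin [CompleteSpace E] [I.Boundaryless]
    [IsManifold I 1 N] {k : N → F} {x : N} {y : E}
    (hy : y ∈ (extChartAt I x).target)
    (hk : MDifferentiableAt I 𝓘(ℝ, F) k ((extChartAt I x).symm y)) (V : ∀ x : N, TangentSpace I x) :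
    fderiv ℝ (k ∘ (extChartAt I x).symm) y
      (chartField I x V y) =
      mvfderiv I k ((extChartAt I x).symm y) (V ((extChartAt I x).symm y)) := by
  have h1 := isInvertible_mfderivWithin_extChartAt_symm (I := I) hy
  refine (fderiv_comp_extChartAt_symm hy hk _).trans ?_
  congr 1
  exact h1.self_apply_inverse _

lemma differentiableAt_chartField [CompleteSpace E] [I.Boundaryless] [IsManifold I 2 N] {x : N}
    {V : ∀ y : N, TangentSpace I y}
    (hV : MDifferentiableAt I I.tangent (fun y => (⟨y, V y⟩ : TangentBundle I N)) x) :
    DifferentiableAt ℝ (chartField I x V) (extChartAt I x x) := by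
  have := MDifferentiableWithinAt.differentiableWithinAt_mpullbackWithin_vectorField
    (mdifferentiableWithinAt_univ.2 hV)
  rw [Set.preimage_univ, Set.univ_inter] at this
  refine this.differentiableAt ?_
  rw [I.range_eq_univ]
  exact univ_mem

lemma ContMDiffAt.contDiffAt_comp_extChartAt_symm [I.Boundaryless] [IsManifold I 2 N] {h : N → F}
    {x : N} (hh : ContMDiffAt I 𝓘(ℝ, F) 2 h x) :
    ContDiffAt ℝ 2 (h ∘ (extChartAt I x).symm) (extChartAt I x x) := by
  have := (contMDiffAt_iff_source (x := x) (I := I)).1 hh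
  rw [I.range_eq_univ, contMDiffWithinAt_univ, contMDiffAt_iff_contDiffAt] at this
  exact this

lemma eventually_mdifferentiableAt_extChartAt_symm [I.Boundaryless] [IsManifold I 2 N] {h : N → F}
    {x : N} (hh : ContMDiffAt I 𝓘(ℝ, F) 2 h x) :
    ∀ᶠ y in 𝓝 (extChartAt I x x),
      MDifferentiableAt I 𝓘(ℝ, F) h ((extChartAt I x).symm y) := by
  have h1 : ∀ᶠ z in 𝓝 x, MDifferentiableAt I 𝓘(ℝ, F) h z := by
    filter_upwards [(contMDiffAt_iff_contMDiffAt_nhds (by simp)).1 hh] with z hz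
    exact hz.mdifferentiableAt (by simp)
  have hc : ContinuousAt (extChartAt I x).symm (extChartAt I x x) := continuousAt_extChartAt_symm x
  rw [← extChartAt_to_inv (I := I) x] at h1
  exact hc.eventually h1

lemma fderiv_chartField_eventuallyEq [CompleteSpace E] [I.Boundaryless] [IsManifold I 2 N]
    {h : N → F} {x : N} (hh : ContMDiffAt I 𝓘(ℝ, F) 2 h x) (V : ∀ y : N, TangentSpace I y) :
    (fun y => fderiv ℝ (h ∘ (extChartAt I x).symm) y (chartField I x V y)) =ᶠ[𝓝 (extChartAt I x x)]
      (fun y => mvfderiv I h y (V y)) ∘ (extChartAt I x).symm := by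
  have : IsManifold I 1 N := IsManifold.of_le (n := 2) (by norm_num)
  filter_upwards [extChartAt_target_mem_nhds (I := I) x,
    eventually_mdifferentiableAt_extChartAt_symm hh] with y hy hy'
  exact fderiv_comp_extChartAt_symm_mpullbackWithin hy hy' V

lemma differentiableAt_fderiv_chartField [CompleteSpace E] [I.Boundaryless] [IsManifold I 2 N]
    {h : N → F} {x : N} (hh : ContMDiffAt I 𝓘(ℝ, F) 2 h x) {V : ∀ y : N, TangentSpace I y}
    (hV : MDifferentiableAt I I.tangent (fun y => (⟨y, V y⟩ : TangentBundle I N)) x) :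
    DifferentiableAt ℝ (fun y => fderiv ℝ (h ∘ (extChartAt I x).symm) y (chartField I x V y))
      (extChartAt I x x) :=
  ((hh.contDiffAt_comp_extChartAt_symm.fderiv_right (m := 1) (by norm_num)).differentiableAt
    (by norm_num)).clm_apply (differentiableAt_chartField hV)

/-- The derivative of a function along a differentiable vector field is differentiable. -/
lemma mdifferentiableAt_mvfderiv_apply [CompleteSpace E] [I.Boundaryless] [IsManifold I 2 N]
    {h : N → F} {x : N} (hh : ContMDiffAt I 𝓘(ℝ, F) 2 h x) {V : ∀ y : N, TangentSpace I y}
    (hV : MDifferentiableAt I I.tangent (fun y => (⟨y, V y⟩ : TangentBundle I N)) x) :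
    MDifferentiableAt I 𝓘(ℝ, F) (fun y => mvfderiv I h y (V y)) x := by
  have : IsManifold I 1 N := IsManifold.of_le (n := 2) (by norm_num)
  rw [← mdifferentiableWithinAt_univ]
  refine DifferentiableWithinAt.mdifferentiableWithinAt_of_comp_extChartAt_symm ?_
  rw [Set.preimage_univ, Set.univ_inter, I.range_eq_univ, differentiableWithinAt_univ]
  exact (differentiableAt_fderiv_chartField hh hV).congr_of_eventuallyEq
    (fderiv_chartField_eventuallyEq hh V).symm

/-- The Lie bracket of vector fields acts on vector-valued functions as the commutator of
derivations. -/
lemma mvfderiv_mlieBracket [CompleteSpace E] [I.Boundaryless] [IsManifold I 2 N] {h : N → F} {x : N}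
    (hh : ContMDiffAt I 𝓘(ℝ, F) 2 h x) {V W : ∀ x : N, TangentSpace I x}
    (hV : MDifferentiableAt I I.tangent (fun y => (⟨y, V y⟩ : TangentBundle I N)) x)
    (hW : MDifferentiableAt I I.tangent (fun y => (⟨y, W y⟩ : TangentBundle I N)) x) :
    mvfderiv I h x (mlieBracket I V W x) =
      mvfderiv I (fun y => mvfderiv I h y (W y)) x (V x) -
      mvfderiv I (fun y => mvfderiv I h y (V y)) x (W x) := by
  have : IsManifold I 1 N := IsManifold.of_le (n := 2) (by norm_num)
  set φ := extChartAt I x with hφ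
  have hxt : φ x ∈ φ.target := mem_extChartAt_target x
  have hx : φ.symm (φ x) = x := extChartAt_to_inv x
  have hmd := eventually_mdifferentiableAt_extChartAt_symm hh
  have hsm := hh.contDiffAt_comp_extChartAt_symm
  have key2 : ∀ U U' : ∀ x : N, TangentSpace I x,
      MDifferentiableAt I I.tangent (fun y => (⟨y, U y⟩ : TangentBundle I N)) x →
      fderiv ℝ (fun y => fderiv ℝ (h ∘ φ.symm) y
        (chartField I x U y)) (φ x)
        (chartField I x U' (φ x)) =
      mvfderiv I (fun y => mvfderiv I h y (U y)) x (U' x) := by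
    intro U U' hU
    have hmg := mdifferentiableAt_mvfderiv_apply hh hU
    rw [Filter.EventuallyEq.fderiv_eq (fderiv_chartField_eventuallyEq hh U)]
    have := fderiv_comp_extChartAt_symm_mpullbackWithin (I := I) (x := x) hxt
      (k := fun y => mvfderiv I h y (U y)) (by rw [hx]; exact hmg) U'
    refine this.trans ?_
    rw [hx]
  have hbr : mvfderiv I h x (mlieBracket I V W x) = fderiv ℝ (h ∘ φ.symm) (φ x)
      (lieBracket ℝ (chartField I x V)
        (chartField I x W) (φ x)) := by
    have h4 : (mfderiv I 𝓘(ℝ, E) φ x).inverse =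
        mfderivWithin 𝓘(ℝ, E) I φ.symm (Set.range I) (φ x) := by
      have e1 : ∀ z, z = x → (mfderiv I 𝓘(ℝ, E) φ z : E →L[ℝ] E) = mfderiv I 𝓘(ℝ, E) φ x := by
        rintro _ rfl
        rfl
      have e2 := mfderiv_extChartAt_comp_mfderivWithin_extChartAt_symm (I := I) hxt
      have e3 := mfderivWithin_extChartAt_symm_comp_mfderiv_extChartAt (I := I) hxt
      exact ContinuousLinearMap.inverse_eq
        ((congrArg (fun L : E →L[ℝ] E => L ∘L (mfderivWithin 𝓘(ℝ, E) I φ.symm (Set.range I) (φ x) :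
          E →L[ℝ] E)) (e1 _ hx)).symm.trans e2)
        ((congrArg (fun L : E →L[ℝ] E => (mfderivWithin 𝓘(ℝ, E) I φ.symm (Set.range I) (φ x) :
          E →L[ℝ] E) ∘L L) (e1 _ hx)).symm.trans e3)
    have h5 : mlieBracket I V W x = (mfderiv I 𝓘(ℝ, E) φ x).inverse
        (lieBracket (E := E) ℝ (chartField I x V) (chartField I x W) (φ x)) := by
      rw [← mlieBracketWithin_univ, mlieBracketWithin_apply, ← lieBracketWithin_univ (E := E),
        Set.preimage_univ, Set.univ_inter, ← hφ]
      simp only [← I.range_eq_univ]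
      rfl
    have h6 : ∀ z, z = x → ∀ v : E, mvfderiv I h z v = mvfderiv I h x v := by
      rintro _ rfl v
      rfl
    rw [h5, h4, fderiv_comp_extChartAt_symm hxt hmd.self_of_nhds]
    exact (h6 _ hx _).symm
  rw [hbr, fderiv_apply_lieBracket_of_isSymmSndFDerivAt hsm (hsm.isSymmSndFDerivAt (by simp))
    (differentiableAt_chartField hW) (differentiableAt_chartField hV), key2 W V hW, key2 V W hV]


variable {E' : Type*} [NormedAddCommGroup E'] [NormedSpace ℝ E']
    {H' : Type*} [TopologicalSpace H'] {I' : ModelWithCorners ℝ E' H'}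
    {N' : Type*} [TopologicalSpace N'] [ChartedSpace H' N']

/-- If two pairs of vector fields are related by a map, so are their Lie brackets. -/
lemma mfderiv_mlieBracket_of_related [CompleteSpace E] [I.Boundaryless] [IsManifold I 2 N]
    [CompleteSpace E'] [I'.Boundaryless] [IsManifold I' 2 N'] {f : N → N'} {x : N}
    (hf : ContMDiffAt I I' 2 f x)
    {V W : ∀ y : N, TangentSpace I y} {V' W' : ∀ y : N', TangentSpace I' y}
    (hV : MDifferentiableAt I I.tangent (fun y => (⟨y, V y⟩ : TangentBundle I N)) x)
    (hW : MDifferentiableAt I I.tangent (fun y => (⟨y, W y⟩ : TangentBundle I N)) x)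
    (hV' : MDifferentiableAt I' I'.tangent (fun y => (⟨y, V' y⟩ : TangentBundle I' N')) (f x))
    (hW' : MDifferentiableAt I' I'.tangent (fun y => (⟨y, W' y⟩ : TangentBundle I' N')) (f x))
    (hVV' : ∀ᶠ y in 𝓝 x, mfderiv I I' f y (V y) = V' (f y))
    (hWW' : ∀ᶠ y in 𝓝 x, mfderiv I I' f y (W y) = W' (f y)) :
    mfderiv I I' f x (mlieBracket I V W x) = mlieBracket I' V' W' (f x) := by
  have hI : IsManifold I 1 N := IsManifold.of_le (n := 2) (by norm_num)
  have hI' : IsManifold I' 1 N' := IsManifold.of_le (n := 2) (by norm_num)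
  set h := extChartAt I' (f x)
  have hh : ContMDiffAt I' 𝓘(ℝ, E') 2 h (f x) := contMDiffAt_extChartAt
  have hhf : ContMDiffAt I 𝓘(ℝ, E') 2 (fun y => h (f y)) x := hh.comp x hf
  have hfd := hf.mdifferentiableAt (by simp)
  have hinv : Function.Injective (mvfderiv I' h (f x)) :=
    (isInvertible_mfderiv_extChartAt (mem_extChartAt_source (f x))).injective
  have hev : ∀ᶠ y in 𝓝 x, MDifferentiableAt I I' f y := by
    filter_upwards [(contMDiffAt_iff_contMDiffAt_nhds (by simp)).1 hf] with z hz
    exact hz.mdifferentiableAt (by simp)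
  have hev' : ∀ᶠ y in 𝓝 x, MDifferentiableAt I' 𝓘(ℝ, E') h (f y) := by
    refine hf.continuousAt.eventually
      (p := fun z => MDifferentiableAt I' 𝓘(ℝ, E') h z) ?_
    filter_upwards [(contMDiffAt_iff_contMDiffAt_nhds (by simp)).1 hh] with z hz
    exact hz.mdifferentiableAt (by simp)
  have key : ∀ (U : ∀ y : N, TangentSpace I y) (U' : ∀ y : N', TangentSpace I' y),
      (∀ᶠ y in 𝓝 x, mfderiv I I' f y (U y) = U' (f y)) →
      (fun y => mvfderiv I (fun y => h (f y)) y (U y)) =ᶠ[𝓝 x]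
        fun y => (fun z => mvfderiv I' h z (U' z)) (f y) := by
    intro U U' hU
    filter_upwards [hU, hev, hev'] with y h1 h2 h3
    rw [mvfderiv_comp_mfderiv y h3 h2, h1]
  have key2 : ∀ (U T : ∀ y : N, TangentSpace I y) (U' T' : ∀ y : N', TangentSpace I' y),
      (∀ᶠ y in 𝓝 x, mfderiv I I' f y (U y) = U' (f y)) →
      (∀ᶠ y in 𝓝 x, mfderiv I I' f y (T y) = T' (f y)) →
      MDifferentiableAt I' I'.tangent (fun y => (⟨y, U' y⟩ : TangentBundle I' N')) (f x) →
      mvfderiv I (fun y => mvfderiv I (fun y => h (f y)) y (U y)) x (T x) =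
        mvfderiv I' (fun z => mvfderiv I' h z (U' z)) (f x) (T' (f x)) := by
    intro U T U' T' hU hT hU'
    have e1 : mvfderiv I (fun y => mvfderiv I (fun y => h (f y)) y (U y)) x (T x) =
        mvfderiv I (fun y => (fun z => mvfderiv I' h z (U' z)) (f y)) x (T x) :=
      congrArg (fun L : E →L[ℝ] E' => L (T x)) (Filter.EventuallyEq.mfderiv_eq (key U U' hU))
    rw [e1, mvfderiv_comp_mfderiv (g := fun z => mvfderiv I' h z (U' z)) x
      (mdifferentiableAt_mvfderiv_apply hh hU') hfd, hT.self_of_nhds]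
  apply hinv
  rw [← mvfderiv_comp_mfderiv x (hh.mdifferentiableAt (by simp)) hfd, mvfderiv_mlieBracket hhf hV hW,
    mvfderiv_mlieBracket hh hV' hW', key2 W V W' V' hWW' hVV' hW', key2 V W V' W' hVV' hWW' hV']

/-- The Lie bracket with a vector field expanded in a frame. -/
lemma mlieBracket_sum_smul_right [CompleteSpace E] [IsManifold I 2 N] {ι : Type*} (s : Finset ι)
    (V : ∀ y : N, TangentSpace I y) (c : ι → N → ℝ) (W : ι → ∀ y : N, TangentSpace I y) {x : N}
    (hc : ∀ k, MDifferentiableAt I 𝓘(ℝ, ℝ) (c k) x)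
    (hW : ∀ k, MDifferentiableAt I I.tangent (fun y => (⟨y, W k y⟩ : TangentBundle I N)) x) :
    MDifferentiableAt I I.tangent
      (fun y => (⟨y, ∑ k ∈ s, c k y • W k y⟩ : TangentBundle I N)) x ∧
    mlieBracket I V (fun y => ∑ k ∈ s, c k y • W k y) x =
      ∑ k ∈ s, (mvfderiv I (c k) x (V x) • W k x + c k x • mlieBracket I V (W k) x) := by
  classical
  induction s using Finset.induction_on with
  | empty =>
    simp only [Finset.sum_empty]
    exact ⟨Bundle.mdifferentiableAt_zeroSection .., congrFun mlieBracket_zero_right x⟩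
  | insert k s hk ih =>
    simp only [Finset.sum_insert hk]
    have h1 : MDifferentiableAt I I.tangent
      (fun y => (⟨y, c k y • W k y⟩ : TangentBundle I N)) x := MDifferentiableAt.smul_section (hc k) (hW k)
    refine ⟨mdifferentiableAt_add_section h1 ih.1, ?_⟩
    have := mlieBracket_add_right (V := V) h1 ih.1
    refine this.trans ?_
    rw [ih.2]
    congr 1
    exact mlieBracket_smul_right (hc k) (hW k)

end

/-! ### Lie brackets with fundamental vector fields of an action -/

section
variable {E : Type*} [NormedAddCommGroup E] [NormedSpace ℝ E]
  {H : Type*} [TopologicalSpace H] {I : ModelWithCorners ℝ E H}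
  {N : Type*} [TopologicalSpace N] [ChartedSpace H N]
  {E' : Type*} [NormedAddCommGroup E'] [NormedSpace ℝ E']
    {H' : Type*} [TopologicalSpace H'] {J : ModelWithCorners ℝ E' H'}
    {Q : Type*} [TopologicalSpace Q] [ChartedSpace H' Q]
  {F : Type*} [NormedAddCommGroup F] [NormedSpace ℝ F]

open Filter Topology

/-- The vector field on a product given by a vector field on each factor. -/
def prodField (V : ∀ y : N, TangentSpace I y) (W : ∀ q : Q, TangentSpace J q) (p : N × Q) :
    TangentSpace (I.prod J) p :=
  (V p.1, W p.2)

lemma mdifferentiableAt_prodField [IsManifold I 2 N] [IsManifold J 2 Q] {V : ∀ y : N, TangentSpace I y}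
    {W : ∀ q : Q, TangentSpace J q} {p : N × Q}
    (hV : MDifferentiableAt I I.tangent (fun y => (⟨y, V y⟩ : TangentBundle I N)) p.1)
    (hW : MDifferentiableAt J J.tangent (fun y => (⟨y, W y⟩ : TangentBundle J Q)) p.2) :
    MDifferentiableAt (I.prod J) (I.prod J).tangent
      (fun z => (⟨z, prodField V W z⟩ : TangentBundle (I.prod J) (N × Q))) p := by
  have h1 := (hV.comp p mdifferentiableAt_fst).prodMk (hW.comp p mdifferentiableAt_snd)
  have h2 := (contMDiff_equivTangentBundleProd_symm (n := 1) (I := I) (M := N) (I' := J) (M' := Q)).mdifferentiable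
    (by simp) (⟨p.1, V p.1⟩, ⟨p.2, W p.2⟩)
  exact h2.comp p h1

section Partial

variable {E'' : Type*} [NormedAddCommGroup E''] [NormedSpace ℝ E'']
    {H'' : Type*} [TopologicalSpace H''] {K : ModelWithCorners ℝ E'' H''}
    {Y : Type*} [TopologicalSpace Y] [ChartedSpace H'' Y]

lemma mfderiv_prod_apply_left {f : N × Q → Y} {p : N × Q}
    (hf : MDifferentiableAt (I.prod J) K f p) (v : E) :
    (mfderiv (I.prod J) K f p : E × E' →L[ℝ] E'') (v, 0) =
      (mfderiv I K (fun z => f (z, p.2)) p.1 : E →L[ℝ] E'') v := by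
  rw [mfderiv_prod_eq_add_comp hf]
  exact (congrArg (_ + ·) (map_zero (mfderiv J K (fun z => f (p.1, z)) p.2))).trans (add_zero _)

lemma mfderiv_prod_apply_right {f : N × Q → Y} {p : N × Q}
    (hf : MDifferentiableAt (I.prod J) K f p) (w : E') :
    (mfderiv (I.prod J) K f p : E × E' →L[ℝ] E'') (0, w) =
      (mfderiv J K (fun z => f (p.1, z)) p.2 : E' →L[ℝ] E'') w := by
  rw [mfderiv_prod_eq_add_comp hf]
  exact (congrArg (· + _) (map_zero (mfderiv I K (fun z => f (z, p.2)) p.1))).trans (zero_add _)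

end Partial

lemma mvfderiv_clm_comp {F' : Type*} [NormedAddCommGroup F'] [NormedSpace ℝ F'] (L : F →L[ℝ] F')
    {f : N → F} {x : N} (hf : MDifferentiableAt I 𝓘(ℝ, F) f x) (v : TangentSpace I x) :
    mvfderiv I (fun y => L (f y)) x v = L (mvfderiv I f x v) := by
  rw [mvfderiv_comp_mfderiv (g := L) x L.differentiableAt.mdifferentiableAt hf]
  refine (mvfderiv_eq_fderiv _ _).trans ?_
  rw [L.fderiv]
  rfl

/-- Vector fields pulled back from different factors of a product commute. -/
lemma mlieBracket_prodField_zero [CompleteSpace E] [I.Boundaryless] [IsManifold I 2 N]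
    [CompleteSpace E'] [J.Boundaryless] [IsManifold J 2 Q]
    {V : ∀ y : N, TangentSpace I y}
    {W : ∀ q : Q, TangentSpace J q} {p : N × Q}
    (hV : MDifferentiableAt I I.tangent (fun y => (⟨y, V y⟩ : TangentBundle I N)) p.1)
    (hW : MDifferentiableAt J J.tangent (fun y => (⟨y, W y⟩ : TangentBundle J Q)) p.2) :
    mlieBracket (I.prod J) (prodField 0 W) (prodField V 0) p = 0 := by
  have hI : IsManifold I 1 N := IsManifold.of_le (n := 2) (by norm_num)
  have hJ : IsManifold J 1 Q := IsManifold.of_le (n := 2) (by norm_num)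
  have h01 : MDifferentiableAt I I.tangent
    (fun y => (⟨y, (0 : ∀ y : N, TangentSpace I y) y⟩ : TangentBundle I N)) p.1 :=
    Bundle.mdifferentiableAt_zeroSection ..
  have h02 : MDifferentiableAt J J.tangent
    (fun y => (⟨y, (0 : ∀ y : Q, TangentSpace J y) y⟩ : TangentBundle J Q)) p.2 :=
    Bundle.mdifferentiableAt_zeroSection ..
  have hA := mdifferentiableAt_prodField h01 hW
  have hB := mdifferentiableAt_prodField hV h02
  have e1 := mfderiv_mlieBracket_of_related (f := (Prod.fst : N × Q → N)) (x := p)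
    (contMDiffAt_fst) hA hB h01 hV (.of_forall fun y => by rw [mfderiv_fst]; rfl)
    (.of_forall fun y => by rw [mfderiv_fst]; rfl)
  have e2 := mfderiv_mlieBracket_of_related (f := (Prod.snd : N × Q → Q)) (x := p)
    (contMDiffAt_snd) hA hB hW h02 (.of_forall fun y => by rw [mfderiv_snd]; rfl)
    (.of_forall fun y => by rw [mfderiv_snd]; rfl)
  rw [mfderiv_fst, mlieBracket_zero_left] at e1
  rw [mfderiv_snd, mlieBracket_zero_right] at e2
  exact Prod.ext e1 e2

variable [Group Q]

lemma mulInvariantVectorField_one (a : TangentSpace J (1 : Q)) :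
    mulInvariantVectorField a (1 : Q) = a := by
  have h : (fun q : Q => 1 * q) = id := funext one_mul
  exact (congrArg (fun f : Q → Q => (mfderiv J J f 1 : E' →L[ℝ] E') a) h).trans
    (congrArg (fun L : E' →L[ℝ] E' => L a) (mfderiv_id (I := J) (x := (1 : Q))))

variable [LieGroup J ∞ Q]

/-- If the action of `q` maps the field `X (α q)` to the field `X A`, then the bracket of the
fundamental vector field `ζ` of `a` with `X A` is the value of `X` on the derivative of `α` along
`a`. -/
lemma mlieBracket_fundamental [CompleteSpace E] [I.Boundaryless] [IsManifold I 2 N]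
    [CompleteSpace E'] [J.Boundaryless] [FiniteDimensional ℝ F]
    {act : N → Q → N} (hact : ContMDiff (I.prod J) I 2 (fun z : N × Q => act z.1 z.2))
    (act_one : ∀ u, act u 1 = u) (act_mul : ∀ u q r, act u (q * r) = act (act u q) r)
    (X : ∀ u : N, F →L[ℝ] TangentSpace I u)
    (hX : ∀ A, MDifferentiable I I.tangent (fun u => (⟨u, X u A⟩ : TangentBundle I N)))
    {α : Q → F} {A : F} (hα : MDifferentiableAt J 𝓘(ℝ, F) α 1)
    (hrel : ∀ u q, mfderiv I I (fun v => act v q) u (X u (α q)) = X (act u q) A)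
    (a : TangentSpace J (1 : Q)) {ζ : ∀ u : N, TangentSpace I u}
    (hζ : ∀ u, (ζ u : E) = mfderiv J I (fun q => act u q) 1 a)
    (hζd : MDifferentiable I I.tangent (fun u => (⟨u, ζ u⟩ : TangentBundle I N))) (u : N) :
    mlieBracket I ζ (fun u => X u A) u = X u (mvfderiv J α 1 a) := by
  have hJ2 : LieGroup J (minSmoothness ℝ 3) Q := LieGroup.of_le (m := minSmoothness ℝ 3) (n := ∞) (by
    rw [minSmoothness_of_isRCLikeNormedField]; exact ENat.LEInfty.out)
  have hM2 : IsManifold J 2 Q := IsManifold.of_le (n := ∞) ENat.LEInfty.out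
  have hM1 : IsManifold J 1 Q := IsManifold.of_le (n := ∞) ENat.LEInfty.out
  have hI1 : IsManifold I 1 N := IsManifold.of_le (n := 2) (by norm_num)
  set b := Module.finBasis ℝ F
  set aL : ∀ q : Q, TangentSpace J q := mulInvariantVectorField a
  have haL : MDifferentiable J J.tangent (fun y => (⟨y, aL y⟩ : TangentBundle J Q)) :=
    mdifferentiable_mulInvariantVectorField a
  have hm := hact.mdifferentiable (by simp)
  have hc : ∀ k, MDifferentiableAt J 𝓘(ℝ, ℝ) (fun q => b.repr (α q) k) 1 := fun k =>
    (LinearMap.toContinuousLinearMap (b.coord k)).differentiableAt.comp_mdifferentiableAt hα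
  have hc' : ∀ k, MDifferentiableAt (I.prod J) 𝓘(ℝ, ℝ)
      (fun p : N × Q => b.repr (α p.2) k) (u, 1) := fun k =>
    (hc k).comp (u, (1 : Q)) mdifferentiableAt_snd
  have hz : MDifferentiableAt I I.tangent
      (fun y => (⟨y, (0 : ∀ y : N, TangentSpace I y) y⟩ : TangentBundle I N)) u :=
    Bundle.mdifferentiableAt_zeroSection ..
  have hz' : MDifferentiableAt J J.tangent
      (fun y => (⟨y, (0 : ∀ y : Q, TangentSpace J y) y⟩ : TangentBundle J Q)) 1 :=
    Bundle.mdifferentiableAt_zeroSection ..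
  have hV := mdifferentiableAt_prodField (p := (u, (1 : Q))) hz (haL 1)
  have hE : ∀ k, MDifferentiableAt (I.prod J) (I.prod J).tangent
      (fun z => (⟨z, prodField (fun v => X v (b k)) (0 : ∀ q : Q, TangentSpace J q) z⟩ :
        TangentBundle (I.prod J) (N × Q))) (u, 1) := fun k =>
    mdifferentiableAt_prodField (p := (u, (1 : Q))) (hX (b k) u) hz'
  obtain ⟨hW, hbr⟩ := mlieBracket_sum_smul_right Finset.univ (prodField 0 aL)
    (fun k (p : N × Q) => b.repr (α p.2) k)
    (fun k => prodField (fun v => X v (b k)) (0 : ∀ q : Q, TangentSpace J q)) hc' hE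
  -- the field `(X (α q), 0)` on the product is related by the action to `X A`
  have hWeq : ∀ p : N × Q, (∑ k, b.repr (α p.2) k •
      prodField (fun v => X v (b k)) (0 : ∀ q : Q, TangentSpace J q) p : E × E') =
      ((X p.1 (α p.2) : E), (0 : E')) := by
    intro p
    have e1 : (∑ k, b.repr (α p.2) k • ((X p.1 (b k) : E), (0 : E'))) =
        ((X p.1 (α p.2) : E), (0 : E')) := by
      conv_rhs => rw [← b.sum_repr (α p.2)]
      refine Prod.ext ?_ ?_
      · rw [Prod.fst_sum]
        exact (map_sum (X p.1) _ _).symm ▸ Finset.sum_congr rfl fun k _ =>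
          ((X p.1).map_smul _ _).symm
      · rw [Prod.snd_sum]
        exact Finset.sum_eq_zero fun k _ => smul_zero _
    exact e1
  have hrelV : ∀ p : N × Q, mfderiv (I.prod J) I (fun z : N × Q => act z.1 z.2) p
      (prodField 0 aL p) = ζ (act p.1 p.2) := by
    intro p
    refine (mfderiv_prod_apply_right (hm p) (aL p.2)).trans ?_
    refine Eq.trans ?_ (hζ _).symm
    have h1 : (fun q => act (act p.1 p.2) q) = fun q => act p.1 (p.2 * q) := by
      ext q
      exact (act_mul _ _ _).symm
    rw [h1]
    have h2 : MDifferentiableAt J I (fun q => act p.1 q) (p.2 * 1) :=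
      (hm (p.1, p.2 * 1)).comp (p.2 * 1) (mdifferentiableAt_const.prodMk mdifferentiableAt_id)
    have h3 : MDifferentiableAt J J (fun q => p.2 * q) 1 :=
      (contMDiff_mul_left (I := J) (n := ∞)).mdifferentiable (by simp) 1
    have h4 : ∀ z, z = p.2 → (mfderiv J I (fun q => act p.1 q) z : E' →L[ℝ] E) (aL p.2) =
        (mfderiv J I (fun q => act p.1 q) p.2 : E' →L[ℝ] E) (aL p.2) := by
      rintro _ rfl
      rfl
    exact (h4 _ (mul_one _)).symm.trans (mfderiv_comp_apply (I' := J) 1 h2 h3 a).symm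
  have hrelW : ∀ p : N × Q, mfderiv (I.prod J) I (fun z : N × Q => act z.1 z.2) p
      (∑ k, b.repr (α p.2) k •
      prodField (fun v => X v (b k)) (0 : ∀ q : Q, TangentSpace J q) p) = X (act p.1 p.2) A := by
    intro p
    refine (congrArg (mfderiv (I.prod J) I (fun z : N × Q => act z.1 z.2) p : E × E' →L[ℝ] E)
      (hWeq p)).trans ((mfderiv_prod_apply_left (hm p) _).trans ?_)
    exact hrel p.1 p.2
  have key := mfderiv_mlieBracket_of_related (x := (u, (1 : Q))) hact.contMDiffAt hV hW
    (hζd _) (hX A _) (.of_forall hrelV) (.of_forall hrelW)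
  rw [hbr] at key
  have hcast : ∀ z, z = u → (mlieBracket I ζ (fun u => X u A) z : E) =
      mlieBracket I ζ (fun u => X u A) u := by
    rintro _ rfl
    rfl
  refine (hcast _ (act_one u)).symm.trans (key.symm.trans ?_)
  have h0 : ∀ k, mlieBracket (I.prod J) (prodField 0 aL)
      (prodField (fun v => X v (b k)) (0 : ∀ q : Q, TangentSpace J q)) (u, 1) = 0 := fun k =>
    mlieBracket_prodField_zero (p := (u, (1 : Q))) (hX (b k) u) (haL 1)
  have hα' : X u (mvfderiv J α 1 a) = ∑ k, mvfderiv J (fun q => b.repr (α q) k) 1 a • X u (b k) := by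
    conv_lhs => rw [← b.sum_repr (mvfderiv J α 1 a)]
    rw [map_sum]
    refine Finset.sum_congr rfl fun k _ => ?_
    rw [map_smul]
    congr 1
    exact (mvfderiv_clm_comp (LinearMap.toContinuousLinearMap (b.coord k)) hα a).symm
  rw [hα']
  simp only [h0, smul_zero, add_zero]
  have h5 : ∀ k, mvfderiv (I.prod J) (fun p : N × Q => b.repr (α p.2) k) (u, 1)
      (prodField 0 aL (u, 1)) = mvfderiv J (fun q => b.repr (α q) k) 1 a := by
    intro k
    refine (mvfderiv_comp_mfderiv (f := Prod.snd) (g := fun q => b.repr (α q) k) (u, (1 : Q))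
      (hc k) mdifferentiableAt_snd _).trans ?_
    rw [mfderiv_snd]
    exact congrArg (mvfderiv J (fun q => b.repr (α q) k) 1) (mulInvariantVectorField_one a)
  simp only [h5]
  refine (map_sum (mfderiv (I.prod J) I (fun z : N × Q => act z.1 z.2) (u, 1)) _ _).trans
    (Finset.sum_congr rfl fun k _ => ?_)
  refine (map_smul (mfderiv (I.prod J) I (fun z : N × Q => act z.1 z.2) (u, 1)) _ _).trans ?_
  congr 1
  refine (mfderiv_prod_apply_left (hm _) _).trans ?_
  have h6 : (fun z => act z 1) = id := funext act_one
  exact (congrArg (fun f : N → N => (mfderiv I I f u : E →L[ℝ] E) (X u (b k))) h6).trans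
    (congrArg (fun L : E →L[ℝ] E => L (X u (b k))) (mfderiv_id (I := I) (x := u)))
end

/-! ### The adjoint representation -/

namespace RelativeTractor

/-- The model space of an `n`-dimensional manifold. -/
abbrev Euc (n : ℕ) : Type := EuclideanSpace ℝ (Fin n)

section

variable {nG : ℕ} {G : Type*} [TopologicalSpace G] [ChartedSpace (Euc nG) G]
  [Group G]

lemma Ad_one : Ad (nG := nG) (1 : G) = ContinuousLinearMap.id ℝ _ := by
  have h : (fun x : G => 1 * x * 1⁻¹) = id := by ext; simp
  have e := congrArg (β := Euc nG →L[ℝ] Euc nG) (fun f : G → G => mfderiv (𝓡 nG) (𝓡 nG) f 1) h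
  exact e.trans (mfderiv_id (I := 𝓡 nG) (x := (1 : G)))

variable [LieGroup (𝓡 nG) ∞ G]

lemma contMDiff_conj (g : G) : ContMDiff (𝓡 nG) (𝓡 nG) ∞ (fun x : G => g * x * g⁻¹) :=
  (contMDiff_mul_right (a := g⁻¹)).comp (contMDiff_mul_left (a := g))

lemma Ad_mul (g h : G) (A : GroupLieAlgebra (𝓡 nG) G) : Ad (g * h) A = Ad g (Ad h A) := by
  have h1 : (fun x : G => g * h * x * (g * h)⁻¹) =
      (fun x : G => g * x * g⁻¹) ∘ (fun x : G => h * x * h⁻¹) := by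
    ext
    simp [mul_assoc]
  have h2 : MDifferentiableAt (𝓡 nG) (𝓡 nG) (fun x : G => g * x * g⁻¹) (h * 1 * h⁻¹) :=
    (contMDiff_conj g).mdifferentiable (by simp) _
  have h3 : MDifferentiableAt (𝓡 nG) (𝓡 nG) (fun x : G => h * x * h⁻¹) 1 :=
    (contMDiff_conj h).mdifferentiable (by simp) _
  have h4 : ∀ z, z = 1 → ∀ A, (mfderiv (𝓡 nG) (𝓡 nG) (fun x : G => g * x * g⁻¹) z :
    Euc nG →L[ℝ] Euc nG) A = (Ad g :
    Euc nG →L[ℝ] Euc nG) A := by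
    rintro _ rfl A
    rfl
  refine (congrArg (fun f : G → G => (mfderiv (𝓡 nG) (𝓡 nG) f 1 :
    Euc nG →L[ℝ] Euc nG) A) h1).trans ?_
  exact (mfderiv_comp_apply (I' := 𝓡 nG) 1 h2 h3 A).trans (h4 _ (by simp) _)

lemma Ad_inv_Ad (g : G) (A : GroupLieAlgebra (𝓡 nG) G) : Ad g⁻¹ (Ad g A) = A := by
  rw [← Ad_mul, inv_mul_cancel, Ad_one]
  rfl

lemma Ad_Ad_inv (g : G) (A : GroupLieAlgebra (𝓡 nG) G) : Ad g (Ad g⁻¹ A) = A := by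
  rw [← Ad_mul, mul_inv_cancel, Ad_one]
  rfl

lemma mfderiv_conj_mulInvariantVectorField (g x : G) (A : GroupLieAlgebra (𝓡 nG) G) :
    mfderiv (𝓡 nG) (𝓡 nG) (fun x : G => g * x * g⁻¹) x (mulInvariantVectorField A x) =
      mulInvariantVectorField (Ad g A) (g * x * g⁻¹) := by
  have hL : ∀ x y : G, MDifferentiableAt (𝓡 nG) (𝓡 nG) (fun z => x * z) y := fun x y =>
    (contMDiff_mul_left (I := 𝓡 nG) (n := ∞)).mdifferentiable (by simp) _
  have hC : ∀ y : G, MDifferentiableAt (𝓡 nG) (𝓡 nG) (fun x : G => g * x * g⁻¹) y := fun y =>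
    (contMDiff_conj g).mdifferentiable (by simp) _
  have h1 : (fun y : G => g * (x * y) * g⁻¹) = fun y : G => (g * x * g⁻¹) * (g * y * g⁻¹) := by
    ext
    simp [mul_assoc]
  have e1 := mfderiv_comp_apply (I' := 𝓡 nG) (f := fun z => x * z)
    (g := fun x : G => g * x * g⁻¹) 1 (hC _) (hL x 1) A
  have e2 := mfderiv_comp_apply (I' := 𝓡 nG) (f := fun x : G => g * x * g⁻¹)
    (g := fun z => (g * x * g⁻¹) * z) 1 (hL _ _) (hC 1) A
  have h4 : ∀ z, z = x → ∀ A, (mfderiv (𝓡 nG) (𝓡 nG) (fun x : G => g * x * g⁻¹) z :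
    Euc nG →L[ℝ] Euc nG) A =
      (mfderiv (𝓡 nG) (𝓡 nG) (fun x : G => g * x * g⁻¹) x :
    Euc nG →L[ℝ] Euc nG) A := by
    rintro _ rfl A
    rfl
  have h5 : ∀ z, z = 1 → ∀ A, (mfderiv (𝓡 nG) (𝓡 nG) (fun y : G => (g * x * g⁻¹) * y) z :
    Euc nG →L[ℝ] Euc nG) A =
      (mfderiv (𝓡 nG) (𝓡 nG) (fun y : G => (g * x * g⁻¹) * y) 1 :
    Euc nG →L[ℝ] Euc nG) A := by
    rintro _ rfl A
    rfl
  refine (h4 _ (mul_one x) _).symm.trans (e1.symm.trans ?_)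
  refine Eq.trans ?_ (h5 (g * 1 * g⁻¹) (by simp) _)
  refine Eq.trans ?_ e2
  exact congrArg (fun f : G → G => (mfderiv (𝓡 nG) (𝓡 nG) f 1 :
    Euc nG →L[ℝ] Euc nG) A) h1

lemma Ad_lie (g : G) (A A' : GroupLieAlgebra (𝓡 nG) G) : Ad g ⁅A, A'⁆ = ⁅Ad g A, Ad g A'⁆ := by
  have : IsManifold (𝓡 nG) 2 G := IsManifold.of_le (n := ∞) ENat.LEInfty.out
  have h := mfderiv_mlieBracket_of_related (x := (1 : G))
    ((contMDiff_conj (nG := nG) g).of_le ENat.LEInfty.out).contMDiffAt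
    (mdifferentiable_mulInvariantVectorField A 1) (mdifferentiable_mulInvariantVectorField A' 1)
    (mdifferentiable_mulInvariantVectorField (Ad g A) _)
    (mdifferentiable_mulInvariantVectorField (Ad g A') _)
    (.of_forall fun x => mfderiv_conj_mulInvariantVectorField g x A)
    (.of_forall fun x => mfderiv_conj_mulInvariantVectorField g x A')
  have h4 : ∀ z : G, z = 1 → (mlieBracket (𝓡 nG) (mulInvariantVectorField (Ad g A))
      (mulInvariantVectorField (Ad g A')) z : Euc nG) =
      mlieBracket (𝓡 nG) (mulInvariantVectorField (Ad g A))
      (mulInvariantVectorField (Ad g A')) (1 : G) := by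
    rintro _ rfl
    rfl
  exact h.trans (h4 _ (by simp))

/-- The adjoint action of a group element, as an automorphism of the Lie algebra. -/
noncomputable def AdEquiv (g : G) :
    GroupLieAlgebra (𝓡 nG) G ≃ₗ⁅ℝ⁆ GroupLieAlgebra (𝓡 nG) G where
  toFun := Ad g
  map_add' := map_add _
  map_smul' := map_smul _
  map_lie' := Ad_lie g _ _
  invFun := Ad g⁻¹
  left_inv := Ad_inv_Ad g
  right_inv := Ad_Ad_inv g

lemma mdifferentiableAt_Ad_apply (A : GroupLieAlgebra (𝓡 nG) G) :
    MDifferentiableAt (𝓡 nG) 𝓘(ℝ, Euc nG) (M' := Euc nG) (fun g : G => Ad (nG := nG) g A) 1 := by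
  have : IsManifold (𝓡 nG) 1 G := IsManifold.of_le (n := ∞) ENat.LEInfty.out
  have h1 : ContMDiffAt ((𝓡 nG).prod (𝓡 nG)) (𝓡 nG) 2
      (Function.uncurry fun g x : G => g * x * g⁻¹) (1, 1) :=
    (((contMDiff_fst.mul contMDiff_snd).mul contMDiff_fst.inv).of_le
      (m := 2) (n := ∞) ENat.LEInfty.out).contMDiffAt
  have h2 := ContMDiffAt.mfderiv (m := 1) (x₀ := (1 : G)) (fun g x : G => g * x * g⁻¹)
    (fun _ : G => (1 : G)) h1 contMDiffAt_const (by norm_num)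
  have h3 := (h2.mdifferentiableAt (by simp)).clm_apply
    (mdifferentiableAt_const (M' := Euc nG) (c := A))
  refine h3.congr_of_eventuallyEq (.of_forall fun g => ?_)
  have h4 : (fun g : G => g * 1 * g⁻¹) = fun _ => 1 := by ext; simp
  simp only [h4]
  have h5 := inTangentCoordinates_eq (I := 𝓡 nG) (I' := 𝓡 nG) (fun _ : G => (1 : G))
    (fun _ : G => (1 : G)) (fun g => mfderiv (𝓡 nG) (𝓡 nG) (fun x => g * x * g⁻¹) (1 : G))
    (x₀ := 1) (x := g) (mem_chart_source _ _) (mem_chart_source _ _)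
  have hc : ∀ w : EuclideanSpace ℝ (Fin nG), (tangentBundleCore (𝓡 nG) G).coordChange
      (achart (Euc nG) 1) (achart (Euc nG) 1) 1 w = w :=
    fun w => tangentCoordChange_self (I := 𝓡 nG) (mem_extChartAt_source (1 : G))
  refine ((congrArg (fun L : Euc nG →L[ℝ] Euc nG => L A) h5).trans ?_).symm
  exact (hc _).trans (congrArg (Ad (nG := nG) g) (hc A))

variable {nQ : ℕ} {Q : Subgroup G} [ChartedSpace (Euc nQ) Q]

/-- The derivative of the adjoint representation is the adjoint representation of the Lie
algebra. -/
lemma mvfderiv_Ad_apply [LieGroup (𝓡 nQ) ∞ Q]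
    (hQ : ContMDiff (𝓡 nQ) (𝓡 nG) ∞ (fun q : Q => (q : G)))
    (a : TangentSpace (𝓡 nQ) (1 : Q)) (A : GroupLieAlgebra (𝓡 nG) G) :
    mvfderiv (𝓡 nQ) (F := Euc nG) (fun q : Q => Ad (nG := nG) (q : G) A) 1 a =
      (Bracket.bracket (L := GroupLieAlgebra (𝓡 nG) G) (M := GroupLieAlgebra (𝓡 nG) G)
        (mfderiv (𝓡 nQ) (𝓡 nG) (fun q : Q => (q : G)) 1 a) A) := by
  have : IsManifold (𝓡 nG) 2 G := IsManifold.of_le (n := ∞) ENat.LEInfty.out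
  have hact : ContMDiff ((𝓡 nG).prod (𝓡 nQ)) (𝓡 nG) 2
      (fun z : G × Q => (fun (g : G) (q : Q) => g * (q : G)) z.1 z.2) :=
    (contMDiff_fst.mul (hQ.comp contMDiff_snd)).of_le (m := 2) (n := ∞) ENat.LEInfty.out
  have hd : MDifferentiableAt (𝓡 nQ) 𝓘(ℝ, Euc nG) (M' := Euc nG)
      (fun q : Q => Ad (nG := nG) (q : G) A) 1 :=
    MDifferentiableAt.comp (I' := 𝓡 nG) (1 : Q) (mdifferentiableAt_Ad_apply A)
      (hQ.mdifferentiable (by simp) 1)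
  have key := mlieBracket_fundamental (F := Euc nG) (act := fun (g : G) (q : Q) => g * (q : G)) hact (fun g => mul_one g)
    (fun g q r => by simp [mul_assoc]) (fun g => (mfderiv (𝓡 nG) (𝓡 nG) (fun x => g * x) 1 :
      Euc nG →L[ℝ] TangentSpace (𝓡 nG) g)) 
      (fun A => mdifferentiable_mulInvariantVectorField (I := 𝓡 nG) (G := G) A) (A := A) hd ?_ a
      (ζ := mulInvariantVectorField (mfderiv (𝓡 nQ) (𝓡 nG) (fun q : Q => (q : G)) 1 a :
        GroupLieAlgebra (𝓡 nG) G)) ?_ (mdifferentiable_mulInvariantVectorField _) 1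
  · exact (key.trans (mulInvariantVectorField_one _)).symm
  · intro g q
    have hL : ∀ x y : G, MDifferentiableAt (𝓡 nG) (𝓡 nG) (fun z => x * z) y := fun x y =>
      (contMDiff_mul_left (I := 𝓡 nG) (n := ∞)).mdifferentiable (by simp) _
    have hR : ∀ x y : G, MDifferentiableAt (𝓡 nG) (𝓡 nG) (fun z => z * x) y := fun x y =>
      (contMDiff_mul_right (I := 𝓡 nG) (n := ∞)).mdifferentiable (by simp) _
    have hC : MDifferentiableAt (𝓡 nG) (𝓡 nG) (fun x : G => (q : G) * x * (q : G)⁻¹) 1 :=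
      (contMDiff_conj (q : G)).mdifferentiable (by simp) _
    have e1 := mfderiv_comp_apply_of_eq (I' := 𝓡 nG) (g := fun z : G => z * q)
      (f := fun y => g * y) (1 : G) (hR _ g) (hL g 1) (mul_one g) (Ad (q : G) A)
    have e2 := mfderiv_comp_apply_of_eq (I' := 𝓡 nG)
      (g := (fun z : G => z * q) ∘ (fun y => g * y))
      (f := fun x : G => (q : G) * x * (q : G)⁻¹) (1 : G) ((hR _ _).comp _ (hL g 1)) hC (by simp) A
    have h : ((fun z : G => z * q) ∘ (fun y => g * y)) ∘ (fun x : G => (q : G) * x * (q : G)⁻¹) =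
        fun y => g * q * y := by
      ext
      simp [mul_assoc]
    have e3 := congrArg (β := Euc nG) (fun f : G → G => mfderiv (𝓡 nG) (𝓡 nG) f 1 A) h
    exact e1.symm.trans (e2.symm.trans e3)
  · intro g
    exact (mfderiv_comp_apply_of_eq (I' := 𝓡 nG) (f := fun q : Q => (q : G))
      (g := fun x => g * x) (1 : Q) (y := (1 : G))
      ((contMDiff_mul_left (I := 𝓡 nG) (n := ∞)).mdifferentiable (by simp) _)
      (hQ.mdifferentiable (by simp) 1) rfl a).symm

end
end RelativeTractor

/-! ### Automorphisms preserving a parabolic subalgebra -/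

namespace RelativeTractor
noncomputable section

open Module.End in
/-- Commuting operators which are self-adjoint for a positive definite form are simultaneously
diagonalizable. -/
lemma iSup_iInf_eigenspace_eq_top_of_form {V : Type*} [AddCommGroup V] [Module ℝ V]
    [FiniteDimensional ℝ V] (b : V →ₗ[ℝ] V →ₗ[ℝ] ℝ) (hsymm : ∀ x y, b x y = b y x)
    (hpos : ∀ x, x ≠ 0 → 0 < b x x) {ι : Type*} {T : ι → Module.End ℝ V}
    (hT : ∀ i x y, b (T i x) y = b x (T i y)) (hc : ∀ i j, Commute (T i) (T j)) :
    ⨆ χ : ι → ℝ, ⨅ i, eigenspace (T i) (χ i) = ⊤ := by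
  have hnn : ∀ x, 0 ≤ b x x := fun x => by
    by_cases hx : x = 0
    · simp [hx]
    · exact (hpos x hx).le
  let core : InnerProductSpace.Core ℝ V :=
    { inner := fun x y => b x y
      conj_inner_symm := fun x y => hsymm y x
      re_inner_nonneg := hnn
      add_left := fun x y z => by simp
      smul_left := fun x y r => by simp
      definite := fun x hx => by
        by_contra h
        exact (hpos x h).ne' hx }
  let : NormedAddCommGroup V := core.toNormedAddCommGroup
  let : InnerProductSpace ℝ V := InnerProductSpace.ofCore core.toCore
  exact LinearMap.IsSymmetric.iSup_iInf_eq_top_of_commute (𝕜 := ℝ) (E := V)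
    (fun i x y => hT i x y) (fun i j _ => hc i j)

namespace NestedParabolicData

variable {L : Type*} [LieRing L] [LieAlgebra ℝ L] (D : NestedParabolicData L)

lemma killingForm_lie (X Y Z : L) : killingForm ℝ L ⁅X, Y⁆ Z = - killingForm ℝ L Y ⁅X, Z⁆ :=
  LieModule.traceForm_apply_lie_apply' ℝ L L X Y Z

lemma killingForm_symm (X Y : L) : killingForm ℝ L X Y = killingForm ℝ L Y X :=
  LieModule.traceForm_comm ℝ L L X Y

lemma killingForm_θ (X Y : L) : killingForm ℝ L (D.θ X) Y = killingForm ℝ L X (D.θ Y) := by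
  rw [← LieAlgebra.killingForm_of_equiv_apply D.θ X, D.θ_involutive]

lemma eq_zero_of_killingForm {X : L} (h : killingForm ℝ L X (D.θ X) = 0) : X = 0 := by
  by_contra hX
  exact (D.θ_cartan X hX).ne h

lemma θ_mem_rootSpace {χ : Module.Dual ℝ D.𝔞} {X : L} (hX : X ∈ restrictedRootSpace D.𝔞 χ) :
    D.θ X ∈ restrictedRootSpace D.𝔞 (-χ) := by
  intro H
  have h1 : (H : L) = D.θ (-H) := by
    rw [map_neg, D.𝔞_anti H H.2, neg_neg]
  rw [h1, ← LieEquiv.map_lie, neg_lie, hX H]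
  simp

/-- Restricted root spaces are orthogonal for the Killing form unless they are opposite. -/
lemma killingForm_rootSpace {χ ψ : Module.Dual ℝ D.𝔞} (h : χ + ψ ≠ 0) {X Y : L}
    (hX : X ∈ restrictedRootSpace D.𝔞 χ) (hY : Y ∈ restrictedRootSpace D.𝔞 ψ) :
    killingForm ℝ L X Y = 0 := by
  obtain ⟨H, hH⟩ : ∃ H, (χ + ψ) H ≠ 0 := by
    by_contra! h0
    exact h (LinearMap.ext h0)
  have h1 := killingForm_lie (H : L) X Y
  rw [hX H, hY H] at h1
  simp only [map_smul, LinearMap.smul_apply, smul_eq_mul] at h1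
  have h2 : (χ + ψ) H * killingForm ℝ L X Y = 0 := by
    rw [LinearMap.add_apply]
    linarith
  exact (mul_eq_zero.1 h2).resolve_left hH

/-- A subspace which is stable under `𝔞` is spanned by its intersections with the simultaneous
eigenspaces. -/
lemma le_iSup_inf_rootSpace [Module.Finite ℝ L] (U : Submodule ℝ L)
    (hU : ∀ H ∈ D.𝔞, ∀ X ∈ U, ⁅H, X⁆ ∈ U) :
    U ≤ ⨆ χ : Module.Dual ℝ D.𝔞, U ⊓ restrictedRootSpace D.𝔞 χ := by
  let b : U →ₗ[ℝ] U →ₗ[ℝ] ℝ := LinearMap.mk₂ ℝ (fun X Y => - killingForm ℝ L X (D.θ Y))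
    (fun X X' Y => by simp; ring) (fun c X Y => by simp) (fun X Y Y' => by simp; ring)
    (fun c X Y => by simp)
  let T : D.𝔞 → Module.End ℝ U := fun H =>
    (LieAlgebra.ad ℝ L (H : L) : L →ₗ[ℝ] L).restrict (p := U) (q := U) (hU H H.2)
  have hT : ∀ H X, ((T H X : U) : L) = ⁅(H : L), (X : L)⁆ := fun H X => rfl
  have h1 := iSup_iInf_eigenspace_eq_top_of_form b
    (fun X Y => by
      change - killingForm ℝ L X (D.θ Y) = - killingForm ℝ L Y (D.θ X)
      rw [killingForm_symm, killingForm_θ])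
    (fun X hX => by
      have := D.θ_cartan X (by simpa using hX)
      change 0 < - killingForm ℝ L X (D.θ X)
      linarith)
    (T := T)
    (fun H X Y => by
      change - killingForm ℝ L ⁅(H : L), (X : L)⁆ (D.θ Y) = - killingForm ℝ L X (D.θ ⁅(H : L), (Y : L)⁆)
      rw [killingForm_lie, LieEquiv.map_lie, D.𝔞_anti H H.2, neg_lie, map_neg])
    (fun H H' => by
      refine LinearMap.ext fun X => Subtype.ext ?_
      change ⁅(H : L), ⁅(H' : L), (X : L)⁆⁆ = ⁅(H' : L), ⁅(H : L), (X : L)⁆⁆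
      rw [leibniz_lie, D.𝔞_abelian H H.2 H' H'.2, zero_lie, zero_add])
  have h2 : (⊤ : Submodule ℝ U).map U.subtype = U := by simp
  refine h2.symm.le.trans ?_
  rw [← h1, Submodule.map_iSup]
  refine iSup_le fun χ => ?_
  rintro _ ⟨X, hX, rfl⟩
  have hX' : ∀ H : D.𝔞, ⁅(H : L), (X : L)⁆ = χ H • (X : L) := by
    intro H
    have := (Submodule.mem_iInf _).1 hX H
    rw [Module.End.mem_eigenspace_iff] at this
    exact congrArg Subtype.val this
  by_cases h0 : (X : L) = 0
  · rw [Submodule.subtype_apply, h0]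
    exact Submodule.zero_mem _
  -- on a nonzero joint eigenvector, the eigenvalue depends linearly on the element of `𝔞`
  let χ' : Module.Dual ℝ D.𝔞 :=
    { toFun := χ
      map_add' := fun H H' => smul_left_injective ℝ h0 (by
        simp only
        rw [add_smul, ← hX', ← hX', ← hX', Submodule.coe_add, add_lie])
      map_smul' := fun c H => smul_left_injective ℝ h0 (by
        simp only [RingHom.id_apply, smul_eq_mul]
        rw [mul_smul, ← hX', ← hX', Submodule.coe_smul, smul_lie]) }
  exact Submodule.mem_iSup_of_mem χ' ⟨X.2, hX'⟩

lemma rootSpace_le_filt {j : ℤ} {χ : Module.Dual ℝ D.𝔞} (h : (j : ℝ) ≤ D.height D.Sp χ) :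
    restrictedRootSpace D.𝔞 χ ≤ D.filt j := by
  rw [filt_eq]
  exact le_iSup_of_le χ (le_iSup_of_le h le_rfl)

lemma filt_induction {j : ℤ} {p : L → Prop} (h0 : p 0) (hadd : ∀ X Y, p X → p Y → p (X + Y))
    (h : ∀ χ : Module.Dual ℝ D.𝔞, (j : ℝ) ≤ D.height D.Sp χ → ∀ X ∈ restrictedRootSpace D.𝔞 χ, p X)
    {X : L} (hX : X ∈ D.filt j) : p X := by
  rw [filt_eq] at hX
  induction hX using Submodule.iSup_induction' with
  | zero => exact h0
  | add X X' _ _ h h' => exact hadd _ _ h h'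
  | mem χ X hX =>
    by_cases hχ : (j : ℝ) ≤ D.height D.Sp χ
    · simp only [hχ, iSup_pos] at hX
      exact h χ hχ X hX
    · simp [hχ] at hX
      rwa [hX]

lemma height_add (S : Finset (Fin D.rank)) (χ ψ : Module.Dual ℝ D.𝔞) :
    D.height S (χ + ψ) = D.height S χ + D.height S ψ := by
  simp [height, Finset.sum_add_distrib]

lemma height_neg (S : Finset (Fin D.rank)) (χ : Module.Dual ℝ D.𝔞) :
    D.height S (-χ) = - D.height S χ := by
  simp [height]

lemma height_zero (S : Finset (Fin D.rank)) : D.height S 0 = 0 := by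
  simp [height]

lemma height_simple (S : Finset (Fin D.rank)) (k : Fin D.rank) :
    D.height S (D.simple k) = if k ∈ S then 1 else 0 := by
  simp [height, Finsupp.single_apply]

/-- A root vector of height less than `j` which lies in the `j`-th filtration component vanishes. -/
lemma eq_zero_of_mem_filt {j : ℤ} {χ : Module.Dual ℝ D.𝔞} (hχ : D.height D.Sp χ < j) {X : L}
    (hX : X ∈ restrictedRootSpace D.𝔞 χ) (hXj : X ∈ D.filt j) : X = 0 := by
  refine D.eq_zero_of_killingForm ?_
  refine D.filt_induction (p := fun Y => killingForm ℝ L Y (D.θ X) = 0) (by simp) 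
    (fun Y Z hY hZ => by simp [hY, hZ]) (fun ψ hψ Y hY => ?_) hXj
  refine D.killingForm_rootSpace (fun h => ?_) hY (D.θ_mem_rootSpace hX)
  rw [← sub_eq_add_neg, sub_eq_zero] at h
  rw [h] at hψ
  linarith

/-- The nilradical of `𝔭` is the annihilator of `𝔭` for the Killing form. -/
lemma mem_filt_one_iff [Module.Finite ℝ L] (X : L) :
    X ∈ D.filt 1 ↔ ∀ Y ∈ D.pAlg, killingForm ℝ L X Y = 0 := by
  constructor
  · intro hX Y hY
    rw [← D.filt_zero] at hY
    refine D.filt_induction (p := fun X => killingForm ℝ L X Y = 0) (by simp)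
      (fun Y Z hY hZ => by simp [hY, hZ]) (fun χ hχ X hX => ?_) hX
    refine D.filt_induction (p := fun Y => killingForm ℝ L X Y = 0) (by simp)
      (fun Y Z hY hZ => by simp [hY, hZ]) (fun ψ hψ Y hY => ?_) hY
    refine D.killingForm_rootSpace (fun h => ?_) hX hY
    have := D.height_add D.Sp χ ψ
    rw [h, height_zero] at this
    push_cast at hχ hψ
    linarith
  · let U : Submodule ℝ L :=
      { carrier := {X | ∀ Y ∈ D.pAlg, killingForm ℝ L X Y = 0}
        add_mem' := fun {X X'} hX hX' Y hY => by simp [hX Y hY, hX' Y hY]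
        zero_mem' := fun Y _ => by simp
        smul_mem' := fun c X hX Y hY => by simp [hX Y hY] }
    suffices h : U ≤ D.filt 1 from fun hX => h hX
    have h𝔞 : ∀ H ∈ D.𝔞, H ∈ D.pAlg := fun H hH => by
      rw [← D.filt_zero]
      refine D.rootSpace_le_filt (χ := 0) (by simp [height_zero]) fun H' => ?_
      simpa using D.𝔞_abelian H' H'.2 H hH
    refine (D.le_iSup_inf_rootSpace U fun H hH X hX Y hY => ?_).trans (iSup_le fun χ => ?_)
    · rw [killingForm_lie, hX _ (by
        rw [← D.filt_zero] at hY ⊢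
        exact D.lie_pAlg_filt (h𝔞 H hH) hY), neg_zero]
    · rintro X ⟨hX, hXχ⟩
      by_cases h0 : restrictedRootSpace D.𝔞 χ = ⊥
      · have hX0 : X ∈ (⊥ : Submodule ℝ L) := h0 ▸ hXχ
        rw [(Submodule.mem_bot ℝ).1 hX0]
        exact Submodule.zero_mem _
      obtain ⟨n, hn⟩ := D.exists_int_height D.Sp h0
      by_cases h1 : 1 ≤ n
      · exact D.rootSpace_le_filt (by rw [hn]; exact_mod_cast h1) hXχ
      · have h2 : D.θ X ∈ D.pAlg := by
          rw [← D.filt_zero]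
          refine D.rootSpace_le_filt ?_ (D.θ_mem_rootSpace hXχ)
          rw [height_neg, hn]
          exact_mod_cast (by omega : 0 ≤ -n)
        rw [D.eq_zero_of_killingForm (hX _ h2)]
        exact Submodule.zero_mem _

/-- A root vector which is annihilated by all simple root spaces, with root `χ` a
nonpositive combination of simple roots, vanishes unless `χ = 0`. -/
lemma eq_zero_of_forall_lie_simple {χ : Module.Dual ℝ D.𝔞} (hχ : χ ≠ 0)
    (hneg : ∀ k, D.simple.repr χ k ≤ 0) {Z : L} (hZ : Z ∈ restrictedRootSpace D.𝔞 χ)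
    (h : ∀ k, ∀ Y ∈ restrictedRootSpace D.𝔞 (D.simple k), ⁅Y, Z⁆ = 0) : Z = 0 := by
  by_contra hZ0
  have hY : ∀ k, ∃ Y ∈ restrictedRootSpace D.𝔞 (D.simple k), Y ≠ 0 := fun k =>
    (Submodule.ne_bot_iff _).1 (D.simple_isRoot k).2
  choose Y hYk hY0 using hY
  -- `⁅θ Y, Y⁆` is a positive multiple of the element of `𝔞` dual to the simple root
  have hH : ∀ k, ⁅D.θ (Y k), Y k⁆ ∈ D.𝔞 := by
    intro k
    refine D.𝔞_maximal _ ?_ fun W hW => ?_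
    · rw [LieEquiv.map_lie, D.θ_involutive, lie_skew]
    · have := D.lie_mem_rootSpace (D.θ_mem_rootSpace (hYk k)) (hYk k) ⟨W, hW⟩
      rw [neg_add_cancel, LinearMap.zero_apply, zero_smul] at this
      rw [← lie_skew, this, neg_zero]
  set c : Fin D.rank → ℝ := fun k => - killingForm ℝ L (Y k) (D.θ (Y k)) with hc
  have hc0 : ∀ k, 0 < c k := fun k => neg_pos.2 (D.θ_cartan _ (hY0 k))
  have hK : ∀ k (W : D.𝔞), killingForm ℝ L ⁅D.θ (Y k), Y k⁆ W = c k * D.simple k W := by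
    intro k W
    rw [killingForm, LieModule.traceForm_apply_lie_apply, ← lie_skew, hYk k W, ← killingForm, map_neg,
      map_smul, killingForm_symm, smul_eq_mul, hc]
    ring
  have hχH : ∀ k, 0 ≤ χ ⟨_, hH k⟩ := by
    intro k
    have h1 := hZ ⟨_, hH k⟩
    have h2 : ⁅⁅D.θ (Y k), Y k⁆, Z⁆ = - ⁅Y k, ⁅D.θ (Y k), Z⁆⁆ := by
      rw [lie_lie, h k _ (hYk k), lie_zero, zero_sub]
    have h3 : killingForm ℝ L ⁅⁅D.θ (Y k), Y k⁆, Z⁆ (D.θ Z) =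
        killingForm ℝ L ⁅D.θ (Y k), Z⁆ (D.θ ⁅D.θ (Y k), Z⁆) := by
      rw [h2, map_neg, LinearMap.neg_apply, killingForm_lie, neg_neg, LieEquiv.map_lie,
        D.θ_involutive]
    have h4 : killingForm ℝ L ⁅D.θ (Y k), Z⁆ (D.θ ⁅D.θ (Y k), Z⁆) ≤ 0 := by
      by_cases h0 : ⁅D.θ (Y k), Z⁆ = 0
      · simp [h0]
      · exact (D.θ_cartan _ h0).le
    rw [← h3, h1, map_smul, LinearMap.smul_apply, smul_eq_mul] at h4
    exact nonneg_of_mul_nonpos_left h4 (D.θ_cartan Z hZ0)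
  -- the element of `𝔞` dual to `χ`
  set T : D.𝔞 := ∑ k, (D.simple.repr χ k / c k) • (⟨_, hH k⟩ : D.𝔞) with hT
  have hTW : ∀ W : D.𝔞, killingForm ℝ L T W = χ W := by
    intro W
    have h1 := congrArg (fun ψ : Module.Dual ℝ D.𝔞 => ψ W) (D.simple.sum_repr χ)
    simp only [LinearMap.sum_apply, LinearMap.smul_apply, smul_eq_mul] at h1
    rw [← h1, hT]
    simp only [Submodule.coe_sum, Submodule.coe_smul, map_sum, map_smul, LinearMap.sum_apply,
      LinearMap.smul_apply, smul_eq_mul, hK]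
    refine Finset.sum_congr rfl fun k _ => ?_
    rw [← mul_assoc, div_mul_cancel₀ _ (hc0 k).ne']
  have hTT : χ T ≤ 0 := by
    rw [hT]
    simp only [map_sum, map_smul, smul_eq_mul]
    exact Finset.sum_nonpos fun k _ =>
      mul_nonpos_of_nonpos_of_nonneg (div_nonpos_of_nonpos_of_nonneg (hneg k) (hc0 k).le) (hχH k)
  have hT0 : (T : L) = 0 := by
    by_contra h0
    have h1 := D.θ_cartan T h0
    rw [D.𝔞_anti T T.2, map_neg, hTW] at h1
    linarith
  exact hχ (LinearMap.ext fun W => by rw [← hTW, hT0]; simp)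

lemma nonpos_of_height_neg {χ : Module.Dual ℝ D.𝔞} (hχ : D.height D.Sp χ < 0) {Z : L}
    (hZ : Z ∈ restrictedRootSpace D.𝔞 χ) (hZ0 : Z ≠ 0) :
    χ ≠ 0 ∧ (∀ k, D.simple.repr χ k ≤ 0) ∧ ∃ m : ℕ, D.height Finset.univ χ = -(m : ℝ) := by
  have h0 : χ ≠ 0 := by
    rintro rfl
    rw [height_zero] at hχ
    exact lt_irrefl _ hχ
  have hr : IsRestrictedRoot D.𝔞 χ := ⟨h0, (Submodule.ne_bot_iff _).2 ⟨Z, hZ, hZ0⟩⟩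
  rcases D.root_pos_or_neg χ hr with h | h
  · refine absurd hχ (not_lt.2 (Finset.sum_nonneg fun k _ => ?_))
    obtain ⟨n, hn⟩ := h k
    rw [hn]
    positivity
  · choose n hn using h
    refine ⟨h0, fun k => ?_, ∑ k, n k, ?_⟩
    · rw [hn]
      simp
    · simp [height, hn]

/-- The components of negative degree of the filtration are determined by the next one and the
nilradical of `𝔭`. -/
lemma mem_filt_of_lie_filt_one [Module.Finite ℝ L] {j : ℤ} (hj : j ≤ -1) {Z : L}
    (hZ : ∀ Y ∈ D.filt 1, ⁅Y, Z⁆ ∈ D.filt (j + 1)) : Z ∈ D.filt j := by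
  let U : Submodule ℝ L :=
    { carrier := {Z | ∀ Y ∈ D.filt 1, ⁅Y, Z⁆ ∈ D.filt (j + 1)}
      add_mem' := fun {Z Z'} hZ hZ' Y hY => by
        rw [lie_add]
        exact Submodule.add_mem _ (hZ Y hY) (hZ' Y hY)
      zero_mem' := fun Y _ => by simp
      smul_mem' := fun c Z hZ Y hY => by
        rw [lie_smul]
        exact Submodule.smul_mem _ c (hZ Y hY) }
  have hU : ∀ A ∈ D.filt 0, ∀ Z ∈ U, ⁅A, Z⁆ ∈ U := by
    intro A hA Z hZ Y hY
    rw [leibniz_lie]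
    refine Submodule.add_mem _ (hZ _ ?_) ?_
    · simpa using D.lie_mem_filt hY hA
    · simpa using D.lie_mem_filt hA (hZ Y hY)
  have hj' : (j : ℝ) < 0 := by exact_mod_cast (by omega : j < 0)
  -- induction on the height of a negative root: the simple root spaces in `𝔭` act trivially by the
  -- induction hypothesis, the remaining ones by the definition of `U`
  have key : ∀ n : ℕ, ∀ χ : Module.Dual ℝ D.𝔞, D.height Finset.univ χ = -(n : ℝ) →
      D.height D.Sp χ < j → ∀ Z ∈ U, Z ∈ restrictedRootSpace D.𝔞 χ → Z = 0 := by
    intro n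
    induction n using Nat.strong_induction_on with
    | _ n ih =>
      intro χ hn hχ Z hZU hZ
      by_contra hZ0
      obtain ⟨h0, hneg, -⟩ := D.nonpos_of_height_neg (hχ.trans hj') hZ hZ0
      refine hZ0 (D.eq_zero_of_forall_lie_simple h0 hneg hZ fun k Y hY => ?_)
      have hYZ := D.lie_mem_rootSpace hY hZ
      have hS := D.height_add D.Sp (D.simple k) χ
      rw [height_simple] at hS
      by_cases hk : k ∈ D.Sp
      · rw [if_pos hk] at hS
        refine D.eq_zero_of_mem_filt (j := j + 1) ?_ hYZ (hZU Y (D.rootSpace_le_filt ?_ hY))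
        · push_cast
          linarith
        · simp [height_simple, hk]
      · rw [if_neg hk, zero_add] at hS
        by_contra hne
        obtain ⟨-, -, m, hm⟩ := D.nonpos_of_height_neg (by linarith) hYZ hne
        have h1 := D.height_add Finset.univ (D.simple k) χ
        rw [height_simple, if_pos (Finset.mem_univ k), hn, hm] at h1
        have h2 : m + 1 = n := by
          have : ((m + 1 : ℕ) : ℝ) = n := by push_cast; linarith
          exact_mod_cast this
        refine hne (ih m (by omega) _ hm (by linarith) _ (hU Y (D.rootSpace_le_filt ?_ hY) Z hZU) hYZ)
        simp [height_simple, hk]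
  suffices h : U ≤ D.filt j from h hZ
  refine (D.le_iSup_inf_rootSpace U fun H hH => hU H ?_).trans (iSup_le fun χ => ?_)
  · refine D.rootSpace_le_filt (χ := 0) (by simp [height_zero]) fun H' => ?_
    simpa using D.𝔞_abelian H' H'.2 H hH
  · rintro Z ⟨hZU, hZ⟩
    by_cases hχ : (j : ℝ) ≤ D.height D.Sp χ
    · exact D.rootSpace_le_filt hχ hZ
    push Not at hχ
    by_cases hZ0 : Z = 0
    · rw [hZ0]
      exact Submodule.zero_mem _
    obtain ⟨-, -, m, hm⟩ := D.nonpos_of_height_neg (hχ.trans hj') hZ hZ0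
    exact absurd (key m χ hm hχ Z hZU hZ) hZ0

/-- Automorphisms preserving `𝔭` preserve the components of nonpositive degree of the filtration. -/
lemma map_filt [Module.Finite ℝ L] (φ : L ≃ₗ⁅ℝ⁆ L) (hφ : ∀ X ∈ D.pAlg, φ X ∈ D.pAlg) {j : ℤ}
    (hj : j ≤ 0) {X : L} (hX : X ∈ D.filt j) : φ X ∈ D.filt j := by
  have h1 : ∀ Y ∈ D.filt 1, φ.symm Y ∈ D.filt 1 := by
    intro Y hY
    rw [mem_filt_one_iff] at hY ⊢
    intro A hA
    rw [← LieAlgebra.killingForm_of_equiv_apply φ, LieEquiv.apply_symm_apply]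
    exact hY _ (hφ A hA)
  obtain ⟨n, rfl⟩ : ∃ n : ℕ, j = -(n : ℤ) := ⟨j.natAbs, by omega⟩
  induction n generalizing X with
  | zero =>
    simp only [Nat.cast_zero, neg_zero, filt_zero] at hX ⊢
    exact hφ X hX
  | succ n ih =>
    refine D.mem_filt_of_lie_filt_one (by push_cast; omega) fun Y hY => ?_
    have h2 : ⁅Y, φ X⁆ = φ ⁅φ.symm Y, X⁆ := by
      rw [LieEquiv.map_lie, LieEquiv.apply_symm_apply]
    have h3 : (1 : ℤ) + -((n + 1 : ℕ) : ℤ) = -(n : ℤ) := by push_cast; ring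
    have h4 : -((n + 1 : ℕ) : ℤ) + 1 = -(n : ℤ) := by push_cast; ring
    have h5 := D.lie_mem_filt (h1 Y hY) hX
    rw [h3] at h5
    rw [h2, h4]
    exact ih (by omega) h5

lemma qAlg_le_filt {j : ℤ} (hj : j ≤ 0) : D.qAlg ≤ D.filt j := by
  refine (iSup_le fun χ => iSup_le fun hχ => ?_ : D.qAlg ≤ D.filt 0).trans (D.filt_anti hj)
  by_cases hb : restrictedRootSpace D.𝔞 χ = ⊥
  · rw [hb]
    exact bot_le
  refine D.rootSpace_le_filt ?_
  rw [Int.cast_zero]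
  by_cases h0 : χ = 0
  · rw [h0, height_zero]
  rcases D.root_pos_or_neg χ ⟨h0, hb⟩ with h | h
  · refine Finset.sum_nonneg fun k _ => ?_
    obtain ⟨n, hn⟩ := h k
    rw [hn]
    positivity
  · -- the coefficients are nonpositive, so omitting some of them increases the height
    have hle : ∀ k ∈ D.Sq, 0 ≤ -D.simple.repr χ k := by
      intro k _
      obtain ⟨n, hn⟩ := h k
      rw [hn, neg_neg]
      positivity
    have hs : D.height D.Sp χ ≥ D.height D.Sq χ := by
      have := Finset.sum_le_sum_of_subset_of_nonneg D.Sp_subset_Sq fun k hk _ => hle k hk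
      rw [Finset.sum_neg_distrib, Finset.sum_neg_distrib, neg_le_neg_iff] at this
      exact this
    exact hχ.trans hs

end NestedParabolicData
end
end RelativeTractor

/-! ### Smoothness of the vector fields `ω⁻¹(s)` -/

namespace RelativeTractor
noncomputable section

namespace CartanGeometry

section Smooth

variable {nG nQ nM nB : ℕ}
    {G : Type*} [TopologicalSpace G] [ChartedSpace (Euc nG) G] [Group G]
    {Q : Subgroup G} [ChartedSpace (Euc nQ) Q]
    {M : Type*} [TopologicalSpace M] [ChartedSpace (Euc nM) M]
    {B : Type*} [TopologicalSpace B] [ChartedSpace (Euc nB) B]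
    [IsManifold (𝓡 nB) ∞ B]
    (C : CartanGeometry (nG := nG) (nQ := nQ) (nM := nM) (nB := nB) Q M B)

/-- The vector field `ω⁻¹(s)` on the total space given by a function `s` with values in `𝔤`. -/
def field (s : B → Euc nG) (u : B) : TangentSpace (𝓡 nB) u := (C.form u).symm (s u)

lemma contMDiff_form_apply :
    ContMDiff (𝓡 nB).tangent 𝓘(ℝ, Euc nG) (M' := Euc nG) ∞
      (fun X : TangentBundle (𝓡 nB) B => C.form X.proj X.snd) := by
  have h : ContMDiff (𝓡 nB).tangent 𝓘(ℝ, Fin nG → ℝ) ∞ (fun X : TangentBundle (𝓡 nB) B =>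
      EuclideanSpace.equiv (Fin nG) ℝ (C.form X.proj X.snd)) := by
    rw [contMDiff_pi_space]
    intro j
    exact C.contMDiff_form ((EuclideanSpace.proj j : Euc nG →L[ℝ] ℝ) : Euc nG →ₗ[ℝ] ℝ)
  exact ((EuclideanSpace.equiv (Fin nG) ℝ).symm.contDiff.contMDiff.comp h)

/-- `ω⁻¹(s)` is a smooth vector field if `s` is smooth. -/
lemma contMDiffAt_field {s : B → Euc nG} {u : B} (hs : ContMDiffAt (𝓡 nB) 𝓘(ℝ, Euc nG) ∞ s u) :
    ContMDiffAt (𝓡 nB) (𝓡 nB).tangent ∞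
      (fun v => (⟨v, C.field s v⟩ : TangentBundle (𝓡 nB) B)) u := by
  set e := trivializationAt (Euc nB) (TangentSpace (𝓡 nB) : B → Type _) u with he
  have hu : u ∈ e.baseSet := FiberBundle.mem_baseSet_trivializationAt' u
  let T : B → Euc nB →L[ℝ] Euc nG := fun v => ContinuousLinearMap.comp (M₃ := Euc nG)
    (C.form v : TangentSpace (𝓡 nB) v →L[ℝ] GroupLieAlgebra (𝓡 nG) G) (e.symmL ℝ v)
  have hT1 : ∀ w : Euc nB, ContMDiffAt (𝓡 nB) 𝓘(ℝ, Euc nG) ∞ (fun v => T v w) u := by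
    intro w
    have h1 : ContMDiffAt (𝓡 nB) (𝓡 nB).tangent ∞
        (fun v => (⟨v, e.symm v w⟩ : TangentBundle (𝓡 nB) B)) u := by
      rw [e.contMDiffAt_section_iff hu]
      refine (contMDiffAt_const (c := w)).congr_of_eventuallyEq ?_
      filter_upwards [e.open_baseSet.mem_nhds hu] with v hv
      rw [e.apply_mk_symm hv]
    have h2 := (contMDiff_form_apply C).contMDiffAt.comp u h1
    refine h2.congr_of_eventuallyEq ?_
    filter_upwards [e.open_baseSet.mem_nhds hu] with v hv
    exact congrArg (C.form v) (e.symmL_apply (R := ℝ) hv w)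
  have hT : ContMDiffAt (𝓡 nB) 𝓘(ℝ, Euc nB →L[ℝ] Euc nG) ∞ T u := by
    let b := EuclideanSpace.basisFun (Fin nB) ℝ
    have h2 : ContMDiffAt (𝓡 nB) 𝓘(ℝ, Euc nB →L[ℝ] Euc nG) ∞ (fun v => ∑ j,
        ContinuousLinearMap.smulRightL ℝ (Euc nB) (Euc nG) (EuclideanSpace.proj j) (T v (b j))) u :=
      contMDiffAt_finsetSum fun j _ =>
        (ContinuousLinearMap.contDiff _).contMDiff.contMDiffAt.comp u (hT1 (b j))
    refine h2.congr_of_eventuallyEq (Filter.Eventually.of_forall fun v => ?_)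
    refine ContinuousLinearMap.ext fun w => ?_
    have h3 : T v w = T v (∑ j, w j • b j) := congrArg (T v) (b.sum_repr w).symm
    rw [h3, map_sum, sum_apply]
    refine Finset.sum_congr rfl fun j _ => ?_
    rw [map_smul]
    rfl
  have hTe : ∀ v ∈ e.baseSet, ∃ F : Euc nB ≃L[ℝ] Euc nG, (F : Euc nB →L[ℝ] Euc nG) = T v ∧ 
    ∀ w, F.symm w = (e ⟨v, (C.form v).symm w⟩).2 := by
    intro v hv
    refine ⟨(e.continuousLinearEquivAt ℝ v hv).symm.trans (C.form v), ?_, ?_⟩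
    · refine ContinuousLinearMap.ext fun w => ?_
      exact congrArg (C.form v) (congrFun (e.symm_continuousLinearEquivAt_eq (R := ℝ) hv) w)
    · intro w
      rfl
  rw [e.contMDiffAt_section_iff hu]
  obtain ⟨F, hF, -⟩ := hTe u hu
  have h3 : ContMDiffAt (𝓡 nB) 𝓘(ℝ, Euc nG →L[ℝ] Euc nB) ∞ 
      (fun v => ContinuousLinearMap.inverse (T v)) u := by
    have := contDiffAt_map_inverse (𝕜 := ℝ) (n := ∞) F
    rw [hF] at this
    exact this.contMDiffAt.comp u hT
  refine (h3.clm_apply hs).congr_of_eventuallyEq ?_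
  filter_upwards [e.open_baseSet.mem_nhds hu] with v hv
  obtain ⟨F, hF, hF2⟩ := hTe v hv
  rw [← hF, ContinuousLinearMap.inverse_equiv]
  exact (hF2 _).symm

end Smooth

end CartanGeometry
end
end RelativeTractor

/-! ### The tangent bundle of the base -/

namespace RelativeTractor
noncomputable section
lemma exists_mfderiv_equiv {E : Type*} [NormedAddCommGroup E] [NormedSpace ℝ E]
    {H : Type*} [TopologicalSpace H] {I : ModelWithCorners ℝ E H}
    {N : Type*} [TopologicalSpace N] [ChartedSpace H N]
    {E' : Type*} [NormedAddCommGroup E'] [NormedSpace ℝ E']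
    {H' : Type*} [TopologicalSpace H'] {I' : ModelWithCorners ℝ E' H'}
    {N' : Type*} [TopologicalSpace N'] [ChartedSpace H' N'] {e : PartialDiffeomorph I I' N N' ∞}
    {u : N} (hu : u ∈ e.source) : ∃ T : E ≃L[ℝ] E', ∀ X, T X = mfderiv I I' e u X := by
  have hl := PartialDiffeomorph.isLocalDiffeomorphAt I I' ∞ e hu
  exact ⟨hl.mfderivToContinuousLinearEquiv (by simp), fun X =>
    congrArg (fun T : E →L[ℝ] E' => T X) (hl.mfderivToContinuousLinearEquiv_coe (by simp))⟩

namespace CartanGeometry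

section Frames

variable {nG nQ nM nB : ℕ}
    {G : Type*} [TopologicalSpace G] [ChartedSpace (Euc nG) G] [Group G]
    {Q : Subgroup G} [ChartedSpace (Euc nQ) Q]
    {M : Type*} [TopologicalSpace M] [ChartedSpace (Euc nM) M]
    {B : Type*} [TopologicalSpace B] [ChartedSpace (Euc nB) B]
    [IsManifold (𝓡 nB) ∞ B]
    (C : CartanGeometry (nG := nG) (nQ := nQ) (nM := nM) (nB := nB) Q M B)

lemma mdifferentiableAt_proj (u : B) : MDifferentiableAt (𝓡 nB) (𝓡 nM) C.proj u :=
  C.contMDiff_proj.mdifferentiable (by simp) u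

lemma exists_trivialization (u : B) :
    ∃ e : PartialDiffeomorph (𝓡 nB) ((𝓡 nM).prod (𝓡 nQ)) B (M × Q) ∞, u ∈ e.source ∧
      (∀ v, C.proj v = C.proj u → v ∈ e.source) ∧
      (∀ v ∈ e.source, ∀ q, (C.proj v, q) ∈ e.target) ∧
      ∀ v ∈ e.source, (e v).1 = C.proj v ∧ ∀ q, (e (C.act v q)).2 = (e v).2 * q := by
  obtain ⟨U, hU, hu, e, hs, ht, he⟩ := C.locally_trivial (C.proj u)
  refine ⟨e, by rwa [hs], fun v hv => ?_, fun v hv q => ?_, he⟩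
  · rw [hs, Set.mem_preimage, hv]
    exact hu
  · rw [ht]
    exact ⟨by rw [hs] at hv; exact hv, trivial⟩

lemma contMDiff_act_left (u : B) : ContMDiff (𝓡 nQ) (𝓡 nB) ∞ (fun q : Q => C.act u q) :=
  C.contMDiff_act.comp (contMDiff_const.prodMk contMDiff_id)

lemma contMDiff_act_right (q : Q) : ContMDiff (𝓡 nB) (𝓡 nB) ∞ (fun u : B => C.act u q) :=
  C.contMDiff_act.comp (contMDiff_id.prodMk contMDiff_const)

/-- The value of `ω⁻¹` on the Lie algebra of the structure group is the fundamental vector field. -/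
lemma form_symm_fundamental (u : B) (a : Euc nQ) :
    ((C.form u).symm (mfderiv (𝓡 nQ) (𝓡 nG) (fun q : Q => (q : G)) 1 a) : Euc nB) =
      (mfderiv (𝓡 nQ) (𝓡 nB) (fun q : Q => C.act u q) 1 a : Euc nB) := by
  have h : ∀ z, z = u → ∀ w : Euc nB, (C.form z w : Euc nG) = C.form u w := by
    rintro _ rfl w
    rfl
  rw [← C.form_fundamental u a]
  refine ((C.form u).symm_apply_eq).2 ?_
  exact h _ (C.act_one u) _

/-- The structure group acts transitively on the fibers. -/
lemma proj_fiber {u v : B} (h : C.proj u = C.proj v) : ∃ q : Q, v = C.act u q := by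
  obtain ⟨e, hu, hf, -, he⟩ := C.exists_trivialization u
  refine ⟨(e u).2⁻¹ * (e v).2, ?_⟩
  have h1 := hf _ h.symm
  have h2 : C.act u ((e u).2⁻¹ * (e v).2) ∈ e.source := hf _ (C.proj_act _ _)
  refine e.injOn h1 h2 (Prod.ext ?_ ?_)
  · exact ((he _ h1).1.trans (h.symm.trans (C.proj_act _ _).symm)).trans (he _ h2).1.symm
  · refine Eq.trans ?_ ((he _ hu).2 _).symm
    simp

lemma fst_mfderiv_trivialization
    {e : PartialDiffeomorph (𝓡 nB) ((𝓡 nM).prod (𝓡 nQ)) B (M × Q) ∞} {u : B} (hu : u ∈ e.source)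
    (he : ∀ v ∈ e.source, (e v).1 = C.proj v) (X : Euc nB) :
    (mfderiv (𝓡 nB) (𝓡 nM) C.proj u X : Euc nM) =
      (mfderiv (𝓡 nB) ((𝓡 nM).prod (𝓡 nQ)) e u X : Euc nM × Euc nQ).1 := by
  have h1 : C.proj =ᶠ[nhds u] fun v => (e v).1 := by
    filter_upwards [e.open_source.mem_nhds hu] with v hv using (he v hv).symm
  have h2 := mfderiv_comp_apply (I' := (𝓡 nM).prod (𝓡 nQ)) (I'' := 𝓡 nM) (g := Prod.fst) u
    mdifferentiableAt_fst (e.mdifferentiableAt (by simp) hu) X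
  have h3 := h1.mfderiv_eq (I := 𝓡 nB) (I' := 𝓡 nM)
  refine (congrArg (fun T : Euc nB →L[ℝ] Euc nM => T X) h3).trans (h2.trans ?_)
  rw [mfderiv_fst]
  rfl

lemma toTangent_apply (u : B) (A : GroupLieAlgebra (𝓡 nG) G) :
    C.toTangent u A = mfderiv (𝓡 nB) (𝓡 nM) C.proj u ((C.form u).symm A) := rfl

lemma toTangent_surjective (u : B) : Function.Surjective (C.toTangent u) := by
  obtain ⟨e, hu, -, -, he⟩ := C.exists_trivialization u
  intro v
  obtain ⟨E, hE⟩ := exists_mfderiv_equiv hu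
  refine ⟨C.form u (E.symm ((v, 0) : Euc nM × Euc nQ)), ?_⟩
  refine (congrArg (fun X : Euc nB => (mfderiv (𝓡 nB) (𝓡 nM) C.proj u X : Euc nM))
    ((C.form u).symm_apply_apply _)).trans ?_
  refine (C.fst_mfderiv_trivialization hu (fun v hv => (he v hv).1) _).trans ?_
  rw [← hE, ContinuousLinearEquiv.apply_symm_apply]

lemma toTangent_fundamental (u : B) (a : Euc nQ) :
    C.toTangent u (mfderiv (𝓡 nQ) (𝓡 nG) (fun q : Q => (q : G)) 1 a) = 0 := by
  rw [toTangent_apply]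
  refine (congrArg (fun X : Euc nB => (mfderiv (𝓡 nB) (𝓡 nM) C.proj u X : Euc nM))
    (C.form_symm_fundamental u a)).trans ?_
  have h1 : (fun q : Q => C.proj (C.act u q)) = fun _ => C.proj u := by
    ext q
    exact C.proj_act u q
  have h2 := mfderiv_comp_apply_of_eq (I' := 𝓡 nB) (1 : Q) (C.mdifferentiableAt_proj u)
    ((C.contMDiff_act_left u).mdifferentiable (by simp) 1) (C.act_one u) a
  refine Eq.trans h2.symm ?_
  refine (congrArg (fun f : Q → M => (mfderiv (𝓡 nQ) (𝓡 nM) f 1 : Euc nQ →L[ℝ] Euc nM) a) h1).trans ?_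
  rw [mfderiv_const]
  rfl

lemma toTangent_act (u : B) (q : Q) (A : GroupLieAlgebra (𝓡 nG) G) :
    (C.toTangent (C.act u q) (Ad (q : G)⁻¹ A) : Euc nM) = C.toTangent u A := by
  have h0 := C.form_equivariant u q ((C.form u).symm A)
  rw [ContinuousLinearEquiv.apply_symm_apply] at h0
  have h1 : (fun v : B => C.proj (C.act v q)) = C.proj := by
    ext v
    exact C.proj_act v q
  have h2 := mfderiv_comp_apply (I' := 𝓡 nB) (g := C.proj) u (C.mdifferentiableAt_proj _)
    ((C.contMDiff_act_right q).mdifferentiable (by simp) u) ((C.form u).symm A)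
  rw [toTangent_apply, ← h0, ContinuousLinearEquiv.symm_apply_apply]
  refine Eq.trans h2.symm ?_
  exact congrArg (fun f : B → M => (mfderiv (𝓡 nB) (𝓡 nM) f u : Euc nB →L[ℝ] Euc nM)
    ((C.form u).symm A)) h1

/-- The kernel of the projection `𝔤 → T_x M` defined by a frame is contained in the Lie algebra of
the structure group. -/
lemma mem_of_toTangent_eq_zero [LieGroup (𝓡 nQ) ∞ Q] {u : B} {A : GroupLieAlgebra (𝓡 nG) G}
    (h : C.toTangent u A = 0) :
    ∃ a : Euc nQ, (mfderiv (𝓡 nQ) (𝓡 nG) (fun q : Q => (q : G)) 1 a : Euc nG) = A := by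
  obtain ⟨e, hu, hf, -, he⟩ := C.exists_trivialization u
  obtain ⟨E, hE⟩ := exists_mfderiv_equiv hu
  set q₀ := (e u).2 with hq
  have hL : ∀ x y : Q, MDifferentiableAt (𝓡 nQ) (𝓡 nQ) (fun z => x * z) y := fun x y =>
    (contMDiff_mul_left (I := 𝓡 nQ) (n := ∞)).mdifferentiable (by simp) _
  set b : Euc nQ := (E ((C.form u).symm A) : Euc nM × Euc nQ).2 with hb
  let a : Euc nQ := mfderiv (𝓡 nQ) (𝓡 nQ) (fun z => q₀⁻¹ * z) q₀ b
  have ha : (mfderiv (𝓡 nQ) (𝓡 nQ) (fun z => q₀ * z) 1 a : Euc nQ) = b := by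
    have h1 := mfderiv_comp_apply_of_eq (I' := 𝓡 nQ) q₀ (hL q₀ 1) (hL q₀⁻¹ q₀)
      (inv_mul_cancel q₀) b
    refine Eq.trans h1.symm ?_
    have h2 : ((fun z => q₀ * z) ∘ fun z => q₀⁻¹ * z) = id := by ext; simp
    refine (congrArg (fun f : Q → Q => (mfderiv (𝓡 nQ) (𝓡 nQ) f q₀ : Euc nQ →L[ℝ] Euc nQ) b)
      h2).trans ?_
    rw [mfderiv_id]
    rfl
  refine ⟨a, ?_⟩
  have hA := C.form_symm_fundamental u a
  refine ((C.form u).symm.injective (E.injective ?_))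
  refine Eq.trans (congrArg (fun X : Euc nB => (E X : Euc nM × Euc nQ)) hA) ?_
  have h1 : (fun q : Q => e (C.act u q)) = fun q => (C.proj u, q₀ * q) := by
    ext q : 1
    refine Prod.ext ?_ ((he u hu).2 q)
    exact (he _ (hf _ (C.proj_act u q))).1.trans (C.proj_act u q)
  have h2 := mfderiv_comp_apply_of_eq (I' := 𝓡 nB) (1 : Q) (e.mdifferentiableAt (by simp) hu)
    ((C.contMDiff_act_left u).mdifferentiable (by simp) 1) (C.act_one u) a
  refine Eq.trans (hE _) (h2.symm.trans ?_)
  refine (congrArg (fun f : Q → M × Q =>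
    (mfderiv (𝓡 nQ) ((𝓡 nM).prod (𝓡 nQ)) f 1 : Euc nQ →L[ℝ] Euc nM × Euc nQ) a) h1).trans ?_
  rw [mfderiv_prodMk mdifferentiableAt_const (hL _ _), mfderiv_const]
  refine Prod.ext ?_ (ha.trans hb)
  refine Eq.trans ?_ (congrArg Prod.fst (hE ((C.form u).symm A))).symm
  exact (h.symm.trans (C.fst_mfderiv_trivialization hu (fun v hv => (he v hv).1) _))

end Frames
end CartanGeometry
end
end RelativeTractor

/-! ### The curvature function -/

namespace RelativeTractor
noncomputable section
/-- The derivative of a `𝔤`-valued function. -/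
def algDeriv {nG nB : ℕ} (G : Type*) [TopologicalSpace G] [ChartedSpace (Euc nG) G] [Group G]
    {B : Type*} [TopologicalSpace B] [ChartedSpace (Euc nB) B] (t : B → Euc nG) (u : B)
    (X : TangentSpace (𝓡 nB) u) : GroupLieAlgebra (𝓡 nG) G :=
  mvfderiv (𝓡 nB) t u X

namespace CartanGeometry

section Curvature

variable {nG nQ nM nB : ℕ}
    {G : Type*} [TopologicalSpace G] [ChartedSpace (Euc nG) G] [Group G]
    {Q : Subgroup G} [ChartedSpace (Euc nQ) Q]
    {M : Type*} [TopologicalSpace M] [ChartedSpace (Euc nM) M]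
    {B : Type*} [TopologicalSpace B] [ChartedSpace (Euc nB) B]
    [IsManifold (𝓡 nB) ∞ B]
    (C : CartanGeometry (nG := nG) (nQ := nQ) (nM := nM) (nB := nB) Q M B)

/-- The Cartan connection at a point as an isomorphism between model spaces, i.e. with the type
synonyms `TangentSpace` and `GroupLieAlgebra` removed. -/
def coframe (u : B) : Euc nB ≃L[ℝ] Euc nG := C.form u

lemma mdifferentiableAt_field {s : B → Euc nG} {u : B}
    (hs : ContMDiffAt (𝓡 nB) 𝓘(ℝ, Euc nG) ∞ s u) :
    MDifferentiableAt (𝓡 nB) (𝓡 nB).tangent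
      (fun v => (⟨v, C.field s v⟩ : TangentBundle (𝓡 nB) B)) u :=
  (C.contMDiffAt_field hs).mdifferentiableAt (by simp)

lemma mdifferentiable_field_const (A : Euc nG) :
    MDifferentiable (𝓡 nB) (𝓡 nB).tangent
      (fun v => (⟨v, C.field (fun _ => A) v⟩ : TangentBundle (𝓡 nB) B)) :=
  fun _ => C.mdifferentiableAt_field contMDiffAt_const

lemma form_field (s : B → Euc nG) (u : B) : (C.form u (C.field s u) : Euc nG) = s u :=
  (C.form u).apply_symm_apply _

lemma form_mlieBracket_sum (V : ∀ u : B, TangentSpace (𝓡 nB) u) {t : B → Euc nG} {u : B}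
    (ht : ContMDiffAt (𝓡 nB) 𝓘(ℝ, Euc nG) ∞ t u) :
    C.coframe u (mlieBracket (𝓡 nB) V (C.field t) u) =
      mvfderiv (𝓡 nB) t u (V u) + ∑ j, t u j • C.coframe u (mlieBracket (𝓡 nB) V
        (C.field fun _ => EuclideanSpace.basisFun (Fin nG) ℝ j) u) := by
  have : IsManifold (𝓡 nB) 2 B := IsManifold.of_le (n := ∞) ENat.LEInfty.out
  set b := EuclideanSpace.basisFun (Fin nG) ℝ
  have h0 : C.field t = fun v => ∑ j, t v j • C.field (fun _ => b j) v := by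
    funext v
    refine (C.form v).injective ?_
    refine (C.form_field t v).trans ?_
    rw [map_sum]
    simp_rw [map_smul]
    have h1 : ∀ j, (C.form v (C.field (fun _ => b j) v) : Euc nG) = b j := fun j => C.form_field _ v
    refine (b.sum_repr (t v)).symm.trans (Finset.sum_congr rfl fun j _ => ?_)
    exact congrArg (fun w : Euc nG => t v j • w) (h1 j).symm
  have hc : ∀ j, MDifferentiableAt (𝓡 nB) 𝓘(ℝ, ℝ) (fun v => t v j) u := fun j =>
    (EuclideanSpace.proj j : Euc nG →L[ℝ] ℝ).differentiableAt.comp_mdifferentiableAt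
      (ht.mdifferentiableAt (by simp))
  have h2 := (mlieBracket_sum_smul_right (I := 𝓡 nB) Finset.univ V (fun j v => t v j)
    (fun j => C.field fun _ => b j) hc fun j => C.mdifferentiable_field_const (b j) u).2
  rw [h0]
  refine (congrArg (C.coframe u) h2).trans ?_
  refine (map_sum (C.coframe u) _ _).trans ?_
  refine (Finset.sum_congr rfl fun j _ => (map_add (C.coframe u) _ _).trans
    (congrArg₂ (· + ·) (map_smul (C.coframe u) _ _) (map_smul (C.coframe u) _ _))).trans ?_
  refine Finset.sum_add_distrib.trans ?_
  refine congrArg₂ (fun a b : Euc nG => a + b) ?_ rfl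
  refine Eq.trans ?_ (b.sum_repr _)
  refine Finset.sum_congr rfl fun j _ => ?_
  have h3 : mvfderiv (𝓡 nB) (fun v => t v j) u (V u) = (mvfderiv (𝓡 nB) t u (V u)) j :=
    mvfderiv_clm_comp (EuclideanSpace.proj j : Euc nG →L[ℝ] ℝ) (ht.mdifferentiableAt (by simp)) _
  refine congrArg₂ (fun (r : ℝ) (a : Euc nG) => r • a) h3 ?_
  exact C.form_field _ u

lemma form_mlieBracket_field_right (V : ∀ u : B, TangentSpace (𝓡 nB) u) {t : B → Euc nG} {u : B}
    (ht : ContMDiffAt (𝓡 nB) 𝓘(ℝ, Euc nG) ∞ t u) :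
    C.coframe u (mlieBracket (𝓡 nB) V (C.field t) u) =
      mvfderiv (𝓡 nB) t u (V u) +
        C.coframe u (mlieBracket (𝓡 nB) V (C.field fun _ => t u) u) := by
  have h1 := C.form_mlieBracket_sum V ht
  have h2 := C.form_mlieBracket_sum V (t := fun _ => t u) (u := u) contMDiffAt_const
  have h3 : mvfderiv (𝓡 nB) (fun _ : B => t u) u (V u) = 0 := by
    have := mfderiv_const (I := 𝓡 nB) (I' := 𝓘(ℝ, Euc nG)) (x := u) (c := t u)
    exact congrArg (fun T : Euc nB →L[ℝ] Euc nG => T (V u)) this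
  rw [h3, zero_add] at h2
  exact h1.trans (congrArg (fun a : Euc nG => mvfderiv (𝓡 nB) t u (V u) + a) h2.symm)

lemma form_mlieBracket_swap (V W : ∀ u : B, TangentSpace (𝓡 nB) u) (u : B) :
    C.form u (mlieBracket (𝓡 nB) V W u) = - C.form u (mlieBracket (𝓡 nB) W V u) := by
  rw [mlieBracket_swap_apply, map_neg]

/-- The structure equation: the bracket of `ω⁻¹(s)` and `ω⁻¹(t)` in terms of the curvature. -/
lemma form_mlieBracket_field {s t : B → Euc nG} {u : B}
    (hs : ContMDiffAt (𝓡 nB) 𝓘(ℝ, Euc nG) ∞ s u) (ht : ContMDiffAt (𝓡 nB) 𝓘(ℝ, Euc nG) ∞ t u) :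
    C.form u (mlieBracket (𝓡 nB) (C.field s) (C.field t) u) =
      algDeriv G t u (C.field s u) - algDeriv G s u (C.field t u) +
      (Bracket.bracket (L := GroupLieAlgebra (𝓡 nG) G) (M := GroupLieAlgebra (𝓡 nG) G)
        (s u) (t u) - C.curvature u (s u) (t u)) := by
  have h1 := C.form_mlieBracket_field_right (C.field s) ht
  have h2 := C.form_mlieBracket_swap (C.field s) (C.field fun _ => t u) u
  have h3 := C.form_mlieBracket_field_right (C.field fun _ => t u) hs
  have h4 := C.form_mlieBracket_swap (C.field fun _ => t u) (C.field fun _ => s u) u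
  have h5 : C.form u (mlieBracket (𝓡 nB) (C.field fun _ => s u) (C.field fun _ => t u) u) =
      (Bracket.bracket (L := GroupLieAlgebra (𝓡 nG) G) (M := GroupLieAlgebra (𝓡 nG) G)
        (s u) (t u) - C.curvature u (s u) (t u) : GroupLieAlgebra (𝓡 nG) G) :=
    (sub_sub_cancel _ _).symm
  have h6 : C.field (fun _ => t u) u = C.field t u := rfl
  refine h1.trans ?_
  have key : ∀ a b c d e f : GroupLieAlgebra (𝓡 nG) G, b = -c → c = d + e → e = - f → a + b = a - d + f := by
    rintro a b c d e f rfl rfl rfl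
    abel
  rw [← h5]
  exact key _ _ _ _ _ _ h2 h3 h4

lemma mfderiv_act_form_symm (u : B) (q : Q) (A : GroupLieAlgebra (𝓡 nG) G) :
    mfderiv (𝓡 nB) (𝓡 nB) (fun v => C.act v q) u ((C.form u).symm A) =
      (C.form (C.act u q)).symm (Ad (q : G)⁻¹ A) := by
  have h := C.form_equivariant u q ((C.form u).symm A)
  rw [ContinuousLinearEquiv.apply_symm_apply] at h
  rw [← h, ContinuousLinearEquiv.symm_apply_apply]

variable [LieGroup (𝓡 nG) ∞ G]

lemma curvature_swap (u : B) (A A' : GroupLieAlgebra (𝓡 nG) G) :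
    C.curvature u A A' = - C.curvature u A' A := by
  rw [curvature, curvature, form_mlieBracket_swap, ← lie_skew]
  abel

lemma curvature_add_right (u : B) (A A₁ A₂ : GroupLieAlgebra (𝓡 nG) G) :
    C.curvature u A (A₁ + A₂) = C.curvature u A A₁ + C.curvature u A A₂ := by
  have : IsManifold (𝓡 nB) 2 B := IsManifold.of_le (n := ∞) ENat.LEInfty.out
  have h0 : (fun v => (C.form v).symm (A₁ + A₂)) =
      (fun v => (C.form v).symm A₁) + fun v => (C.form v).symm A₂ := by
    funext v
    exact map_add (C.form v).symm A₁ A₂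
  have h1 := mlieBracket_add_right (V := fun v => (C.form v).symm A)
    (C.mdifferentiable_field_const A₁ u) (C.mdifferentiable_field_const A₂ u)
  rw [curvature, curvature, curvature, h0, lie_add]
  refine Eq.trans (congrArg (fun X : Euc nB => (⁅A, A₁⁆ + ⁅A, A₂⁆ - C.form u X :
    GroupLieAlgebra (𝓡 nG) G)) h1) ?_
  have h2 := map_add (C.form u) (mlieBracket (𝓡 nB) (fun v => (C.form v).symm A)
    (fun v => (C.form v).symm A₁) u) (mlieBracket (𝓡 nB) (fun v => (C.form v).symm A)
    (fun v => (C.form v).symm A₂) u)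
  refine Eq.trans (congrArg (fun X : GroupLieAlgebra (𝓡 nG) G => ⁅A, A₁⁆ + ⁅A, A₂⁆ - X) h2) ?_
  abel

/-- Equivariance of the curvature function. -/
lemma curvature_act (u : B) (q : Q) (A A' : GroupLieAlgebra (𝓡 nG) G) :
    C.curvature (C.act u q) (Ad (q : G)⁻¹ A) (Ad (q : G)⁻¹ A') =
      Ad (q : G)⁻¹ (C.curvature u A A') := by
  have : IsManifold (𝓡 nB) 2 B := IsManifold.of_le (n := ∞) ENat.LEInfty.out
  have h := mfderiv_mlieBracket_of_related (x := u)
    (((C.contMDiff_act_right q).of_le ENat.LEInfty.out).contMDiffAt)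
    (C.mdifferentiable_field_const A u) (C.mdifferentiable_field_const A' u)
    (C.mdifferentiable_field_const (Ad (q : G)⁻¹ A) (C.act u q))
    (C.mdifferentiable_field_const (Ad (q : G)⁻¹ A') (C.act u q))
    (Filter.Eventually.of_forall fun v => C.mfderiv_act_form_symm v q A)
    (Filter.Eventually.of_forall fun v => C.mfderiv_act_form_symm v q A')
  have h2 := C.form_equivariant u q (mlieBracket (𝓡 nB) (fun v => (C.form v).symm A)
    (fun v => (C.form v).symm A') u)
  rw [curvature, curvature, map_sub, Ad_lie]
  refine congrArg (fun X : GroupLieAlgebra (𝓡 nG) G =>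
    ⁅Ad (q : G)⁻¹ A, Ad (q : G)⁻¹ A'⁆ - X) ?_
  exact (congrArg (fun X : Euc nB => C.form (C.act u q) X) h.symm).trans h2

variable [LieGroup (𝓡 nQ) ∞ Q]

/-- The curvature is horizontal. -/
lemma curvature_fundamental (hQ : ContMDiff (𝓡 nQ) (𝓡 nG) ∞ (fun q : Q => (q : G))) (u : B)
    (a : Euc nQ) (A : GroupLieAlgebra (𝓡 nG) G) :
    C.curvature u (mfderiv (𝓡 nQ) (𝓡 nG) (fun q : Q => (q : G)) 1 a) A = 0 := by
  have : IsManifold (𝓡 nB) 2 B := IsManifold.of_le (n := ∞) ENat.LEInfty.out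
  have hα : MDifferentiableAt (𝓡 nQ) 𝓘(ℝ, Euc nG) (M' := Euc nG)
      (fun q : Q => Ad (nG := nG) (q : G) A) 1 :=
    MDifferentiableAt.comp_of_eq (I' := 𝓡 nG) (1 : Q) (mdifferentiableAt_Ad_apply A)
      (hQ.mdifferentiable (by simp) 1) rfl
  have hrel : ∀ (u : B) (q : Q), mfderiv (𝓡 nB) (𝓡 nB) (fun v => C.act v q) u
      ((C.form u).symm (Ad (q : G) A)) = (C.form (C.act u q)).symm A := by
    intro u q
    rw [mfderiv_act_form_symm, Ad_inv_Ad]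
  have h := mlieBracket_fundamental (I := 𝓡 nB) (J := 𝓡 nQ) (F := Euc nG) (C.contMDiff_act.of_le ENat.LEInfty.out)
    C.act_one C.act_mul
    (fun u => ((C.form u).symm : GroupLieAlgebra (𝓡 nG) G →L[ℝ] TangentSpace (𝓡 nB) u))
    C.mdifferentiable_field_const hα hrel a (C.form_symm_fundamental · a)
    (C.mdifferentiable_field_const _) u
  have h2 := mvfderiv_Ad_apply hQ a A
  rw [curvature, sub_eq_zero]
  symm
  refine Eq.trans (congrArg (fun X : Euc nB => C.form u X) h) ?_
  refine ((C.form u).apply_symm_apply _).trans h2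

end Curvature
end CartanGeometry
end
end RelativeTractor

/-! ### Natural subbundles and torsion -/

namespace RelativeTractor
noncomputable section
namespace CartanGeometry

section Torsion

variable {nG nQ nM nB : ℕ}
    {G : Type*} [TopologicalSpace G] [ChartedSpace (Euc nG) G] [Group G]
    {Q : Subgroup G} [ChartedSpace (Euc nQ) Q]
    {M : Type*} [TopologicalSpace M] [ChartedSpace (Euc nM) M]
    {B : Type*} [TopologicalSpace B] [ChartedSpace (Euc nB) B]
    [IsManifold (𝓡 nB) ∞ B]
    (C : CartanGeometry (nG := nG) (nQ := nQ) (nM := nM) (nB := nB) Q M B)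
    [LieGroup (𝓡 nG) ∞ G]

lemma exists_of_mem_subbundle {W : Submodule ℝ (GroupLieAlgebra (𝓡 nG) G)}
    (hW : ∀ q : Q, ∀ A ∈ W, Ad (q : G) A ∈ W) {u : B} {w : TangentSpace (𝓡 nM) (C.proj u)}
    (hw : w ∈ C.subbundle W (C.proj u)) : ∃ A ∈ W, C.toTangent u A = w := by
  suffices h : C.subbundle W (C.proj u) ≤ W.map (C.toTangent u) from h hw
  have key : ∀ (v : B) (x : M) (h : C.proj v = x) (w : Euc nM),
      w ∈ (Eq.rec (motive := fun y _ => Submodule ℝ (TangentSpace (𝓡 nM) y))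
        (W.map (C.toTangent v)) h : Submodule ℝ (TangentSpace (𝓡 nM) x)) →
      ∃ A ∈ W, (C.toTangent v A : Euc nM) = w := by
    rintro v _ rfl w hw
    exact hw
  refine iSup_le fun v => iSup_le fun h w hw => ?_
  obtain ⟨A, hA, hAw⟩ := key v _ h w hw
  obtain ⟨q, rfl⟩ := C.proj_fiber h.symm
  refine ⟨Ad (q : G) A, hW q A hA, ?_⟩
  refine Eq.trans ?_ hAw
  refine (C.toTangent_act u q _).symm.trans ?_
  rw [Ad_inv_Ad]

variable [LieGroup (𝓡 nQ) ∞ Q]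

/-- Membership in the subbundle defined by an invariant subspace can be tested in every frame. -/
lemma toTangent_mem_iff {W : Submodule ℝ (GroupLieAlgebra (𝓡 nG) G)}
    (hW : ∀ q : Q, ∀ A ∈ W, Ad (q : G) A ∈ W)
    (hQW : ∀ a : Euc nQ, (mfderiv (𝓡 nQ) (𝓡 nG) (fun q : Q => (q : G)) 1 a) ∈ W) {u : B}
    {A : GroupLieAlgebra (𝓡 nG) G} : C.toTangent u A ∈ C.subbundle W (C.proj u) ↔ A ∈ W := by
  refine ⟨fun h => ?_, C.toTangent_mem W u⟩
  obtain ⟨A', hA', h⟩ := C.exists_of_mem_subbundle hW h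
  obtain ⟨a, ha⟩ := C.mem_of_toTangent_eq_zero (u := u) (A := A - A') (by rw [map_sub, h, sub_self])
  have h1 := W.add_mem (hQW a) hA'
  have h2 : (mfderiv (𝓡 nQ) (𝓡 nG) (fun q : Q => (q : G)) 1 a : GroupLieAlgebra (𝓡 nG) G) = A - A' :=
    ha
  rwa [h2, sub_add_cancel] at h1

/-- As the curvature is horizontal, it only depends on the projections of its arguments to `M`. -/
lemma curvature_congr (hQ : ContMDiff (𝓡 nQ) (𝓡 nG) ∞ (fun q : Q => (q : G))) {u : B}
    {A₁ A₂ A₁' A₂' : GroupLieAlgebra (𝓡 nG) G} (h : C.toTangent u A₁ = C.toTangent u A₂)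
    (h' : C.toTangent u A₁' = C.toTangent u A₂') :
    C.curvature u A₁ A₁' = C.curvature u A₂ A₂' := by
  have key : ∀ {A₁ A₂ A : GroupLieAlgebra (𝓡 nG) G}, C.toTangent u A₁ = C.toTangent u A₂ →
      C.curvature u A A₁ = C.curvature u A A₂ := by
    intro A₁ A₂ A h
    obtain ⟨a, ha⟩ := C.mem_of_toTangent_eq_zero (u := u) (A := A₁ - A₂) (by rw [map_sub, h, sub_self])
    have h2 : (mfderiv (𝓡 nQ) (𝓡 nG) (fun q : Q => (q : G)) 1 a : GroupLieAlgebra (𝓡 nG) G) =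
      A₁ - A₂ := ha
    have h3 := C.curvature_fundamental hQ u a A
    rw [h2, curvature_swap, neg_eq_zero] at h3
    have h4 := C.curvature_add_right u A A₂ (A₁ - A₂)
    rw [h3, add_zero, add_sub_cancel] at h4
    exact h4
  rw [key h', C.curvature_swap, key h, ← C.curvature_swap]

lemma torsionAt_toTangent (hQ : ContMDiff (𝓡 nQ) (𝓡 nG) ∞ (fun q : Q => (q : G))) (u : B)
    (A A' : GroupLieAlgebra (𝓡 nG) G) :
    C.torsionAt u (C.toTangent u A) (C.toTangent u A') = C.toTangent u (C.curvature u A A') := by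
  rw [torsionAt, C.curvature_congr hQ
    (Classical.epsilon_spec (p := fun A₁ => C.toTangent u A₁ = C.toTangent u A) ⟨A, rfl⟩)
    (Classical.epsilon_spec (p := fun A₁ => C.toTangent u A₁ = C.toTangent u A') ⟨A', rfl⟩)]

/-- The torsion can be computed in every frame. -/
lemma torsion_toTangent (hQ : ContMDiff (𝓡 nQ) (𝓡 nG) ∞ (fun q : Q => (q : G))) (u : B)
    (A A' : GroupLieAlgebra (𝓡 nG) G) :
    C.torsion (C.proj u) (C.toTangent u A) (C.toTangent u A') =
      C.toTangent u (C.curvature u A A') := by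
  have key : ∀ (v : B) (x : M) (h : C.proj v = x) (a b : Euc nM),
      ((Eq.rec (motive := fun y _ =>
        TangentSpace (𝓡 nM) y → TangentSpace (𝓡 nM) y → TangentSpace (𝓡 nM) y)
        (C.torsionAt v) h : TangentSpace (𝓡 nM) x → TangentSpace (𝓡 nM) x →
          TangentSpace (𝓡 nM) x) a b : Euc nM) = C.torsionAt v a b := by
    rintro v _ rfl a b
    rfl
  refine (key (C.pt (C.proj u)) _ (C.proj_pt _) _ _).trans ?_
  obtain ⟨q, hq⟩ := C.proj_fiber (C.proj_pt (C.proj u)).symm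
  rw [hq]
  refine (congrArg₂ (fun a b : Euc nM => (C.torsionAt (C.act u q) a b : Euc nM))
    (C.toTangent_act u q A).symm (C.toTangent_act u q A').symm).trans ?_
  refine (C.torsionAt_toTangent hQ _ _ _).trans ?_
  rw [C.curvature_act]
  exact C.toTangent_act u q _

end Torsion
end CartanGeometry
end
end RelativeTractor

/-! ### Local lifts of vector fields -/

namespace RelativeTractor
noncomputable section

lemma contMDiffAt_tangentMap {E : Type*} [NormedAddCommGroup E] [NormedSpace ℝ E]
    {H : Type*} [TopologicalSpace H] {I : ModelWithCorners ℝ E H}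
    {N : Type*} [TopologicalSpace N] [ChartedSpace H N] [IsManifold I ∞ N]
    {E' : Type*} [NormedAddCommGroup E'] [NormedSpace ℝ E']
    {H' : Type*} [TopologicalSpace H'] {I' : ModelWithCorners ℝ E' H'}
    {N' : Type*} [TopologicalSpace N'] [ChartedSpace H' N'] [IsManifold I' ∞ N'] {f : N → N'} {O : Set N}
    (hO : IsOpen O) (hf : ContMDiffOn I I' ∞ f O) {p : TangentBundle I N} (hp : p.proj ∈ O) :
    ContMDiffAt I.tangent I'.tangent ∞ (tangentMap I I' f) p := by
  have h1 := hf.contMDiffOn_tangentMapWithin (m := ∞) le_rfl hO.uniqueMDiffOn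
  have hO' : IsOpen (Bundle.TotalSpace.proj ⁻¹' O : Set (TangentBundle I N)) :=
    hO.preimage (FiberBundle.continuous_proj E (TangentSpace I : N → Type _))
  refine (h1.contMDiffAt (hO'.mem_nhds hp)).congr_of_eventuallyEq ?_
  filter_upwards [hO'.mem_nhds hp] with z hz
  exact (tangentMapWithin_eq_tangentMap (hO.uniqueMDiffOn _ hz)
    ((hf.contMDiffAt (hO.mem_nhds hz)).mdifferentiableAt (by simp))).symm

lemma tangentMap_congr_of_eventuallyEq {E : Type*} [NormedAddCommGroup E] [NormedSpace ℝ E]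
    {H : Type*} [TopologicalSpace H] {I : ModelWithCorners ℝ E H}
    {N : Type*} [TopologicalSpace N] [ChartedSpace H N]
    {E' : Type*} [NormedAddCommGroup E'] [NormedSpace ℝ E']
    {H' : Type*} [TopologicalSpace H'] {I' : ModelWithCorners ℝ E' H'}
    {N' : Type*} [TopologicalSpace N'] [ChartedSpace H' N'] {f g : N → N'}
    {p : TangentBundle I N} (h : f =ᶠ[nhds p.proj] g) :
    tangentMap I I' f p = tangentMap I I' g p := by
  have h1 := congrArg (fun T : E →L[ℝ] E' => T p.2) (h.mfderiv_eq (I := I) (I' := I'))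
  rw [tangentMap, tangentMap, Bundle.TotalSpace.mk.injEq]
  exact ⟨h.self_of_nhds, (@heq_of_eq E' _ _ h1)⟩

lemma contMDiffAt_mvfderiv_apply {E : Type*} [NormedAddCommGroup E] [NormedSpace ℝ E]
    {H : Type*} [TopologicalSpace H] {I : ModelWithCorners ℝ E H}
    {N : Type*} [TopologicalSpace N] [ChartedSpace H N] [IsManifold I ∞ N]
    {F : Type*} [NormedAddCommGroup F] [NormedSpace ℝ F] {f : N → F} {O : Set N}
    (hO : IsOpen O) (hf : ContMDiffOn I 𝓘(ℝ, F) ∞ f O) {V : ∀ x : N, TangentSpace I x} {x : N}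
    (hx : x ∈ O)
    (hV : ContMDiffAt I I.tangent ∞ (fun y => (⟨y, V y⟩ : TangentBundle I N)) x) :
    ContMDiffAt I 𝓘(ℝ, F) ∞ (fun y => mvfderiv I f y (V y)) x := by
  have h1 := contMDiffAt_tangentMap hO hf (p := ⟨x, V x⟩) hx
  exact (contMDiff_snd_tangentBundle_modelSpace F 𝓘(ℝ, F)).contMDiffAt.comp x (h1.comp x hV)

/-- The derivative of a function with values in a subspace has values in the subspace. -/
lemma mvfderiv_mem {E : Type*} [NormedAddCommGroup E] [NormedSpace ℝ E]
    {H : Type*} [TopologicalSpace H] {I : ModelWithCorners ℝ E H}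
    {N : Type*} [TopologicalSpace N] [ChartedSpace H N]
    {F : Type*} [NormedAddCommGroup F] [NormedSpace ℝ F] [FiniteDimensional ℝ F] {f : N → F}
    {x : N} (hf : MDifferentiableAt I 𝓘(ℝ, F) f x) {W : Submodule ℝ F}
    (hW : ∀ᶠ y in nhds x, f y ∈ W) (X : TangentSpace I x) : mvfderiv I f x X ∈ W := by
  by_contra h
  obtain ⟨ℓ, h1, h2⟩ := Submodule.exists_le_ker_of_notMem h
  refine h1 ?_
  have h3 := mvfderiv_clm_comp (LinearMap.toContinuousLinearMap ℓ) hf X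
  refine h3.symm.trans ?_
  have h4 : (fun y => LinearMap.toContinuousLinearMap ℓ (f y)) =ᶠ[nhds x] fun _ => (0 : ℝ) := by
    filter_upwards [hW] with y hy using h2 hy
  have h5 := h4.mfderiv_eq (I := I) (I' := 𝓘(ℝ, ℝ))
  rw [mfderiv_const] at h5
  exact congrArg (fun T : E →L[ℝ] ℝ => T X) h5

namespace CartanGeometry

section Lifts

variable {nG nQ nM nB : ℕ}
    {G : Type*} [TopologicalSpace G] [ChartedSpace (Euc nG) G] [Group G]
    {Q : Subgroup G} [ChartedSpace (Euc nQ) Q]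
    {M : Type*} [TopologicalSpace M] [ChartedSpace (Euc nM) M]
    {B : Type*} [TopologicalSpace B] [ChartedSpace (Euc nB) B]
    [IsManifold (𝓡 nB) ∞ B]
    (C : CartanGeometry (nG := nG) (nQ := nQ) (nM := nM) (nB := nB) Q M B)

/-- Near every point there is a smooth local section of the principal bundle. -/
lemma exists_section (u : B) : ∃ S : M → B, ContMDiffAt (𝓡 nM) (𝓡 nB) ∞ S (C.proj u) ∧
    S (C.proj u) = u ∧ ∀ᶠ x in nhds (C.proj u), C.proj (S x) = x := by
  obtain ⟨e, hu, -, ht, he⟩ := C.exists_trivialization u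
  have heu : e u = (C.proj u, (e u).2) := Prod.ext (he u hu).1 rfl
  have hm : (C.proj u, (e u).2) ∈ e.target := ht u hu _
  have hc : ContMDiffAt (𝓡 nM) ((𝓡 nM).prod (𝓡 nQ)) ∞ (fun x : M => (x, (e u).2)) (C.proj u) :=
    contMDiffAt_id.prodMk contMDiffAt_const
  refine ⟨fun x => e.symm (x, (e u).2), ?_, ?_, ?_⟩
  · exact (e.contMDiffOn_invFun.contMDiffAt (e.open_target.mem_nhds hm)).comp (C.proj u) hc
  · have := e.left_inv hu
    rwa [heu] at this
  · filter_upwards [hc.continuousAt.eventually (e.open_target.mem_nhds hm)] with x hx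
    exact (he _ (e.map_target hx)).1.symm.trans (congrArg Prod.fst (e.right_inv hx))

lemma toTangent_form (v : B) (X : TangentBundle (𝓡 nB) B) (h : X.proj = v) :
    (⟨C.proj v, C.toTangent v (C.form X.proj X.snd)⟩ : TangentBundle (𝓡 nM) M) =
      tangentMap (𝓡 nB) (𝓡 nM) C.proj X := by
  subst h
  rw [toTangent_apply, ContinuousLinearEquiv.symm_apply_apply]
  rfl

variable [IsManifold (𝓡 nM) ∞ M]

/-- Every smooth vector field on the base has local smooth lifts to `𝔤`-valued functions, with
prescribed value at a point. -/
lemma exists_lift [LieGroup (𝓡 nQ) ∞ Q] {η : ∀ x : M, TangentSpace (𝓡 nM) x}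
    (hη : ContMDiff (𝓡 nM) (𝓡 nM).tangent ∞ (fun x => (⟨x, η x⟩ : TangentBundle (𝓡 nM) M)))
    {u : B} {A : GroupLieAlgebra (𝓡 nG) G} (hA : C.toTangent u A = η (C.proj u)) :
    ∃ O : Set B, IsOpen O ∧ u ∈ O ∧ ∃ t : B → Euc nG, ContMDiffOn (𝓡 nB) 𝓘(ℝ, Euc nG) ∞ t O ∧
      t u = A ∧ ∀ v ∈ O, C.toTangent v (t v) = η (C.proj v) := by
  have : IsManifold (𝓡 nQ) ∞ Q := inferInstance
  obtain ⟨e, hu, -, ht, he⟩ := C.exists_trivialization u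
  let Z : B → TangentBundle ((𝓡 nM).prod (𝓡 nQ)) (M × Q) := fun v =>
    (equivTangentBundleProd (𝓡 nM) M (𝓡 nQ) Q).symm
      (⟨C.proj v, η (C.proj v)⟩, ⟨(e v).2, (0 : Euc nQ)⟩)
  have hZ : ContMDiffOn (𝓡 nB) ((𝓡 nM).prod (𝓡 nQ)).tangent ∞ Z e.source := by
    have h1 : ContMDiffOn (𝓡 nB) (𝓡 nM).tangent ∞
        (fun v => (⟨C.proj v, η (C.proj v)⟩ : TangentBundle (𝓡 nM) M)) e.source :=
      (hη.comp C.contMDiff_proj).contMDiffOn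
    have h2 : ContMDiffOn (𝓡 nB) (𝓡 nQ).tangent ∞
        (fun v => (⟨(e v).2, (0 : Euc nQ)⟩ : TangentBundle (𝓡 nQ) Q)) e.source :=
      (Bundle.contMDiff_zeroSection ℝ (TangentSpace (𝓡 nQ) : Q → Type _)).comp_contMDiffOn
        (contMDiff_snd.comp_contMDiffOn e.contMDiffOn_toFun)
    exact contMDiff_equivTangentBundleProd_symm.comp_contMDiffOn (h1.prodMk h2)
  let X : B → TangentBundle (𝓡 nB) B := fun v => tangentMap ((𝓡 nM).prod (𝓡 nQ)) (𝓡 nB) e.symm (Z v)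
  have hev : ∀ v ∈ e.source, e v = (C.proj v, (e v).2) := fun v hv => Prod.ext (he v hv).1 rfl
  have hX0 : ∀ v ∈ e.source, (X v).proj = v := by
    intro v hv
    have := e.left_inv hv
    rwa [hev v hv] at this
  have hX : ContMDiffOn (𝓡 nB) (𝓡 nB).tangent ∞ X e.source := by
    intro v hv
    have h1 := contMDiffAt_tangentMap e.open_target e.contMDiffOn_invFun (p := Z v) (ht v hv _)
    exact (h1.comp v (hZ.contMDiffAt (e.open_source.mem_nhds hv))).contMDiffWithinAt
  have hp : ∀ v ∈ e.source, tangentMap (𝓡 nB) (𝓡 nM) C.proj (X v) = ⟨C.proj v, η (C.proj v)⟩ := by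
    intro v hv
    have h1 : (fun z => C.proj (e.symm z)) =ᶠ[nhds (Z v).proj] Prod.fst := by
      filter_upwards [e.open_target.mem_nhds (ht v hv (e v).2)] with z hz
      exact (he _ (e.map_target hz)).1.symm.trans (congrArg Prod.fst (e.right_inv hz))
    have h2 := tangentMap_comp_at (I' := 𝓡 nB) (g := C.proj) (f := e.symm) (Z v)
      (C.mdifferentiableAt_proj _) ((e.symm).mdifferentiableAt (by simp) (ht v hv (e v).2))
    refine h2.symm.trans ((tangentMap_congr_of_eventuallyEq h1).trans ?_)
    rw [tangentMap_prodFst]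
    rfl
  let t₀ : B → Euc nG := fun v => C.form (X v).proj (X v).snd
  have ht₀ : ContMDiffOn (𝓡 nB) 𝓘(ℝ, Euc nG) ∞ t₀ e.source :=
    (contMDiff_form_apply C).comp_contMDiffOn hX
  have ht₁ : ∀ v ∈ e.source, C.toTangent v (t₀ v) = η (C.proj v) := by
    intro v hv
    have h1 := (C.toTangent_form v (X v) (hX0 v hv)).trans (hp v hv)
    simpa using h1
  obtain ⟨c, hc₀, hc⟩ : ∃ c : Euc nG, (∀ v, C.toTangent v c = 0) ∧ t₀ u + c = A := by
    obtain ⟨a, ha⟩ := C.mem_of_toTangent_eq_zero (u := u)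
      (A := A - (show GroupLieAlgebra (𝓡 nG) G from t₀ u)) (by
        rw [map_sub, hA]
        exact sub_eq_zero.2 (ht₁ u hu).symm)
    exact ⟨_, fun v => C.toTangent_fundamental v a,
      (congrArg (fun x : Euc nG => t₀ u + x) ha).trans (add_sub_cancel (t₀ u) (show Euc nG from A))⟩
  refine ⟨e.source, e.open_source, hu, fun v => t₀ v + c, ht₀.add contMDiffOn_const, hc, ?_⟩
  intro v hv
  refine (map_add (C.toTangent v) _ _).trans ?_
  exact (congrArg₂ (fun x y : Euc nM => x + y) (ht₁ v hv) (hc₀ v)).trans (add_zero _)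

end Lifts
end CartanGeometry
end
end RelativeTractor

/-! ### The bracket of vector fields on the base -/

namespace RelativeTractor
noncomputable section

lemma algDeriv_mem {nG nB : ℕ} {G : Type*} [TopologicalSpace G] [ChartedSpace (Euc nG) G] [Group G]
    {B : Type*} [TopologicalSpace B] [ChartedSpace (Euc nB) B] {t : B → Euc nG} {u : B}
    (ht : MDifferentiableAt (𝓡 nB) 𝓘(ℝ, Euc nG) t u)
    {W : Submodule ℝ (GroupLieAlgebra (𝓡 nG) G)} (hW : ∀ᶠ v in nhds u, t v ∈ W)
    (X : TangentSpace (𝓡 nB) u) : algDeriv G t u X ∈ W :=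
  mvfderiv_mem (F := Euc nG) ht (W := W) hW X

lemma dirDeriv_eq {nB : ℕ} {B : Type*} [TopologicalSpace B] [ChartedSpace (Euc nB) B]
    {V : Type*} [AddCommGroup V] [Module ℝ V] [Module.Finite ℝ V] {f : B → V} {u : B}
    {X : TangentSpace (𝓡 nB) u} {z : V}
    (h : ∀ ℓ : V →ₗ[ℝ] ℝ, mvfderiv (𝓡 nB) (fun v => ℓ (f v)) u X = ℓ z) : dirDeriv f u X = z := by
  refine Eq.trans ?_ ((Module.finBasis ℝ V).sum_repr z)
  exact Finset.sum_congr rfl fun k _ => congrArg (· • Module.finBasis ℝ V k)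
    (h ((Module.finBasis ℝ V).coord k))

/-- Derivatives of functions with values in a subquotient are computed on representatives. -/
lemma dirDeriv_mk {nG nB : ℕ} {G : Type*} [TopologicalSpace G] [ChartedSpace (Euc nG) G] [Group G]
    [LieGroup (𝓡 nG) ∞ G]
    {B : Type*} [TopologicalSpace B] [ChartedSpace (Euc nB) B] {t : B → Euc nG} {u : B}
    (ht : MDifferentiableAt (𝓡 nB) 𝓘(ℝ, Euc nG) t u)
    {W W' : Submodule ℝ (GroupLieAlgebra (𝓡 nG) G)}
    {f : B → W ⧸ W'.submoduleOf W}
    (hf : ∀ᶠ v in nhds u, ∃ h : t v ∈ W, f v = Submodule.Quotient.mk ⟨t v, h⟩)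
    (X : TangentSpace (𝓡 nB) u) (hX : algDeriv G t u X ∈ W) :
    dirDeriv f u X = Submodule.Quotient.mk ⟨algDeriv G t u X, hX⟩ := by
  refine dirDeriv_eq fun l => ?_
  obtain ⟨ℓ, hℓ⟩ := LinearMap.exists_extend (l ∘ₗ (W'.submoduleOf W).mkQ)
  have h1 : ∀ A (h : A ∈ W), ℓ A = l (Submodule.Quotient.mk ⟨A, h⟩) := fun A h =>
    LinearMap.congr_fun hℓ ⟨A, h⟩
  let L : Euc nG →ₗ[ℝ] ℝ := ℓ
  have h2 : (fun v => l (f v)) =ᶠ[nhds u] fun v => LinearMap.toContinuousLinearMap L (t v) := by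
    filter_upwards [hf] with v hv
    obtain ⟨hv, hfv⟩ := hv
    exact (congrArg l hfv).trans (h1 _ hv).symm
  have h3 := congrArg (fun T : Euc nB →L[ℝ] ℝ => T X) (h2.mfderiv_eq (I := 𝓡 nB) (I' := 𝓘(ℝ, ℝ)))
  have h4 := mvfderiv_clm_comp (LinearMap.toContinuousLinearMap L) ht X
  exact h3.trans (h4.trans (h1 _ hX))

namespace CartanGeometry

section Main

variable {nG nQ nM nB : ℕ}
    {G : Type*} [TopologicalSpace G] [ChartedSpace (Euc nG) G] [Group G]
    {Q : Subgroup G} [ChartedSpace (Euc nQ) Q]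
    {M : Type*} [TopologicalSpace M] [ChartedSpace (Euc nM) M]
    {B : Type*} [TopologicalSpace B] [ChartedSpace (Euc nB) B]
    [IsManifold (𝓡 nB) ∞ B]
    (C : CartanGeometry (nG := nG) (nQ := nQ) (nM := nM) (nB := nB) Q M B)

/-- The function `D_s t - D_t s + [s, t]`, which represents `[ξ, η] + τ(ξ, η)` if `s` and `t` are
lifts of `ξ` and `η`. -/
def bracketFun (s t : B → Euc nG) (u : B) : GroupLieAlgebra (𝓡 nG) G :=
  algDeriv G t u (C.field s u) - algDeriv G s u (C.field t u) +
    Bracket.bracket (L := GroupLieAlgebra (𝓡 nG) G) (M := GroupLieAlgebra (𝓡 nG) G) (s u) (t u)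

lemma contMDiffAt_toTangent_field {S : M → B} {r : B → Euc nG} {x : M} [IsManifold (𝓡 nM) ∞ M]
    (hS : ContMDiffAt (𝓡 nM) (𝓡 nB) ∞ S x)
    (hr : ContMDiffAt (𝓡 nB) 𝓘(ℝ, Euc nG) ∞ r (S x)) {β : ∀ x : M, TangentSpace (𝓡 nM) x}
    (hS' : ∀ᶠ y in nhds x, C.proj (S y) = y)
    (hβ : ∀ᶠ y in nhds x, β (C.proj (S y)) = C.toTangent (S y) (r (S y))) :
    ContMDiffAt (𝓡 nM) (𝓡 nM).tangent ∞ (fun x => (⟨x, β x⟩ : TangentBundle (𝓡 nM) M)) x := by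
  have h1 := (C.contMDiffAt_field hr).comp x hS
  have h2 := (C.contMDiff_proj.contMDiff_tangentMap (m := ∞) le_rfl).contMDiffAt.comp x h1
  refine h2.congr_of_eventuallyEq ?_
  filter_upwards [hS', hβ] with y hy1 hy2
  have h3 : (⟨y, β y⟩ : TangentBundle (𝓡 nM) M) = ⟨C.proj (S y), β (C.proj (S y))⟩ := by rw [hy1]
  rw [h3, hy2]
  rfl

variable [LieGroup (𝓡 nG) ∞ G]

lemma contMDiffAt_bracketFun {O : Set B} (hO : IsOpen O) {s t : B → Euc nG}
    (hs : ContMDiffOn (𝓡 nB) 𝓘(ℝ, Euc nG) ∞ s O) (ht : ContMDiffOn (𝓡 nB) 𝓘(ℝ, Euc nG) ∞ t O)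
    {u : B} (hu : u ∈ O) :
    ContMDiffAt (𝓡 nB) 𝓘(ℝ, Euc nG) (M' := Euc nG) ∞ (C.bracketFun s t) u := by
  have hs' := hs.contMDiffAt (hO.mem_nhds hu)
  have ht' := ht.contMDiffAt (hO.mem_nhds hu)
  have h1 := contMDiffAt_mvfderiv_apply hO ht hu (C.contMDiffAt_field hs')
  have h2 := contMDiffAt_mvfderiv_apply hO hs hu (C.contMDiffAt_field ht')
  let L : Euc nG →ₗ[ℝ] Euc nG →L[ℝ] Euc nG :=
    (LinearMap.toContinuousLinearMap (𝕜 := ℝ) (E := Euc nG) (F' := Euc nG)).toLinearMap ∘ₗ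
      LinearMap.mk₂ ℝ (M := GroupLieAlgebra (𝓡 nG) G) (Nₗ := GroupLieAlgebra (𝓡 nG) G)
        (Pₗ := GroupLieAlgebra (𝓡 nG) G) (fun A A' => ⁅A, A'⁆)
        add_lie smul_lie lie_add (fun c A A' => lie_smul c A A')
  have h3 : ContMDiffAt (𝓡 nB) 𝓘(ℝ, Euc nG) ∞ (fun v => LinearMap.toContinuousLinearMap L (s v) (t v)) u :=
    ((LinearMap.toContinuousLinearMap L).contDiff.contMDiff.contMDiffAt.comp u hs').clm_apply ht'
  exact (h1.sub h2).add h3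

variable [LieGroup (𝓡 nQ) ∞ Q] [IsManifold (𝓡 nM) ∞ M]

/-- The vector field `[ξ, η] + τ(ξ, η)` is the projection of `bracketFun`: the curvature terms of the
bracket and of the torsion cancel. -/
lemma bracketTorsion_eq (hQ : ContMDiff (𝓡 nQ) (𝓡 nG) ∞ (fun q : Q => (q : G)))
    {ξ η : ∀ x : M, TangentSpace (𝓡 nM) x}
    (hξ : ContMDiff (𝓡 nM) (𝓡 nM).tangent ∞ (fun x => (⟨x, ξ x⟩ : TangentBundle (𝓡 nM) M)))
    (hη : ContMDiff (𝓡 nM) (𝓡 nM).tangent ∞ (fun x => (⟨x, η x⟩ : TangentBundle (𝓡 nM) M)))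
    {O : Set B} (hO : IsOpen O) {s t : B → Euc nG}
    (hs : ContMDiffOn (𝓡 nB) 𝓘(ℝ, Euc nG) ∞ s O) (ht : ContMDiffOn (𝓡 nB) 𝓘(ℝ, Euc nG) ∞ t O)
    (hsξ : ∀ v ∈ O, C.toTangent v (s v) = ξ (C.proj v))
    (htη : ∀ v ∈ O, C.toTangent v (t v) = η (C.proj v)) {u : B} (hu : u ∈ O) :
    C.bracketTorsion ξ η (C.proj u) = C.toTangent u (C.bracketFun s t u) := by
  have : IsManifold (𝓡 nB) 2 B := IsManifold.of_le (n := ∞) ENat.LEInfty.out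
  have : IsManifold (𝓡 nM) 2 M := IsManifold.of_le (n := ∞) ENat.LEInfty.out
  have hs' := hs.contMDiffAt (hO.mem_nhds hu)
  have ht' := ht.contMDiffAt (hO.mem_nhds hu)
  have h1 := mfderiv_mlieBracket_of_related (x := u)
    ((C.contMDiff_proj.of_le ENat.LEInfty.out).contMDiffAt)
    (C.mdifferentiableAt_field hs') (C.mdifferentiableAt_field ht')
    (hξ.mdifferentiable (by simp) _) (hη.mdifferentiable (by simp) _)
    (Filter.eventually_of_mem (hO.mem_nhds hu) hsξ) (Filter.eventually_of_mem (hO.mem_nhds hu) htη)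
  have h2 : mlieBracket (𝓡 nM) ξ η (C.proj u) =
      C.toTangent u (C.form u (mlieBracket (𝓡 nB) (C.field s) (C.field t) u)) := by
    rw [toTangent_apply, ContinuousLinearEquiv.symm_apply_apply, h1]
  have h3 := C.torsion_toTangent hQ u (s u) (t u)
  have h4 := C.form_mlieBracket_field hs' ht'
  rw [bracketTorsion, h2, ← hsξ u hu, ← htη u hu]
  refine (congrArg (fun w => C.toTangent u (C.form u (mlieBracket (𝓡 nB) (C.field s) (C.field t) u)) + w)
    h3).trans ?_
  rw [← map_add, h4]
  congr 1
  rw [bracketFun]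
  abel

/-- Smoothness of `[ξ, η] + τ(ξ, η)`. -/
lemma contMDiff_bracketTorsion (hQ : ContMDiff (𝓡 nQ) (𝓡 nG) ∞ (fun q : Q => (q : G)))
    {ξ η : ∀ x : M, TangentSpace (𝓡 nM) x}
    (hξ : ContMDiff (𝓡 nM) (𝓡 nM).tangent ∞ (fun x => (⟨x, ξ x⟩ : TangentBundle (𝓡 nM) M)))
    (hη : ContMDiff (𝓡 nM) (𝓡 nM).tangent ∞ (fun x => (⟨x, η x⟩ : TangentBundle (𝓡 nM) M))) :
    ContMDiff (𝓡 nM) (𝓡 nM).tangent ∞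
      (fun x => (⟨x, C.bracketTorsion ξ η x⟩ : TangentBundle (𝓡 nM) M)) := by
  intro x
  obtain ⟨u, rfl⟩ := C.proj_surjective x
  obtain ⟨A, hA⟩ := C.toTangent_surjective u (ξ (C.proj u))
  obtain ⟨A', hA'⟩ := C.toTangent_surjective u (η (C.proj u))
  obtain ⟨O₁, hO₁, hu₁, s, hs, -, hsξ⟩ := C.exists_lift hξ hA
  obtain ⟨O₂, hO₂, hu₂, t, ht, -, htη⟩ := C.exists_lift hη hA'
  obtain ⟨S, hS, hSu, hS'⟩ := C.exists_section u
  have hs' := hs.mono (Set.inter_subset_left (s := O₁) (t := O₂))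
  have ht' := ht.mono (Set.inter_subset_right (s := O₁) (t := O₂))
  have hO := hO₁.inter hO₂
  have hu : S (C.proj u) ∈ O₁ ∩ O₂ := by rw [hSu]; exact ⟨hu₁, hu₂⟩
  refine C.contMDiffAt_toTangent_field hS (C.contMDiffAt_bracketFun hO hs' ht' hu) hS' ?_
  filter_upwards [hS.continuousAt.eventually (hO.mem_nhds hu)] with y hy
  exact C.bracketTorsion_eq hQ hξ hη hO hs' ht' (fun v hv => hsξ v hv.1) (fun v hv => htη v hv.2) hy

end Main
end CartanGeometry
end
end RelativeTractor

/-! ### The relative tractor connection -/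

namespace RelativeTractor
noncomputable section
namespace CartanGeometry

section Tractor

variable {nG nQ nM nB : ℕ}
    {G : Type*} [TopologicalSpace G] [ChartedSpace (Euc nG) G] [Group G]
    {Q : Subgroup G} [ChartedSpace (Euc nQ) Q]
    {M : Type*} [TopologicalSpace M] [ChartedSpace (Euc nM) M]
    {B : Type*} [TopologicalSpace B] [ChartedSpace (Euc nB) B]
    [IsManifold (𝓡 nB) ∞ B]
    (C : CartanGeometry (nG := nG) (nQ := nQ) (nM := nM) (nB := nB) Q M B)
    [LieGroup (𝓡 nG) ∞ G] {D : NestedParabolicData (GroupLieAlgebra (𝓡 nG) G)}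

lemma frame_relTractorConnection {i : ℤ} {ξ : ∀ x : M, TangentSpace (𝓡 nM) x}
    {σ ρ : ∀ x, C.VBundle D i x} (hξ : ∀ x, ξ x ∈ C.relTangent D x)
    (hAd : ∀ q : Q, ∀ A ∈ D.pAlg, Ad (q : G) A ∈ D.pAlg)
    (h : ∀ (u : B) (A : D.pAlg), C.toTangent u (A : GroupLieAlgebra (𝓡 nG) G) = ξ (C.proj u) →
      ρ (C.proj u) = C.frame D i u (C.tractorDeriv D σ u A)) :
    ρ = C.relTractorConnection D ξ σ := by
  funext x
  have key : ∀ (u : B) (h : C.proj u = x) (z : C.VBundle D i (C.proj u)), ρ (C.proj u) = z →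
      ρ x = Eq.rec (motive := fun y _ => C.VBundle D i y) z h := by
    rintro u rfl z hz
    exact hz
  refine key (C.pt x) (C.proj_pt x) _ (h _ _ ?_)
  obtain ⟨A, hA, hAξ⟩ := C.exists_of_mem_subbundle hAd (hξ (C.proj (C.pt x)))
  exact Classical.epsilon_spec (p := fun A : D.pAlg =>
    C.toTangent (C.pt x) (A : GroupLieAlgebra (𝓡 nG) G) = ξ (C.proj (C.pt x))) ⟨⟨A, hA⟩, hAξ⟩

variable [LieGroup (𝓡 nQ) ∞ Q]

lemma frame_injective (hAd : ∀ j ≤ 0, ∀ q : Q, ∀ A ∈ D.filt j, Ad (q : G) A ∈ D.filt j)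
    (hD : ∀ j ≤ 0, ∀ a : Euc nQ,
      (mfderiv (𝓡 nQ) (𝓡 nG) (fun q : Q => (q : G)) 1 a) ∈ D.filt j) {i : ℤ} (hi : i < 0) (u : B) :
    Function.Injective (C.frame D i u) := by
  rw [injective_iff_map_eq_zero]
  intro z hz
  obtain ⟨⟨A, hA⟩, rfl⟩ := Submodule.Quotient.mk_surjective _ z
  have h1 : C.frame D i u (Submodule.Quotient.mk ⟨A, hA⟩) =
    Submodule.Quotient.mk ⟨C.toTangent u A, C.toTangent_mem _ u hA⟩ := rfl
  rw [h1, Submodule.Quotient.mk_eq_zero] at hz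
  rw [Submodule.Quotient.mk_eq_zero]
  exact (C.toTangent_mem_iff (hAd (i + 1) (by omega)) (hD (i + 1) (by omega))).1 hz

variable [IsManifold (𝓡 nM) ∞ M]

lemma equivariantFun_project (hAd : ∀ j ≤ 0, ∀ q : Q, ∀ A ∈ D.filt j, Ad (q : G) A ∈ D.filt j)
    (hD : ∀ j ≤ 0, ∀ a : Euc nQ,
      (mfderiv (𝓡 nQ) (𝓡 nG) (fun q : Q => (q : G)) 1 a) ∈ D.filt j) {i : ℤ} (hi : i < 0)
    (η : SmoothSection (C.TP D i)) {u : B} {A : GroupLieAlgebra (𝓡 nG) G}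
    (hA : C.toTangent u A = η.toFun (C.proj u)) :
    ∃ h : A ∈ D.filt i, C.equivariantFun D (C.project D η) u = Submodule.Quotient.mk ⟨A, h⟩ := by
  have h : A ∈ D.filt i := by
    rw [← C.toTangent_mem_iff (hAd i hi.le) (hD i hi.le) (u := u), hA]
    exact η.mem _
  refine ⟨h, ?_⟩
  have h1 : C.project D η (C.proj u) = C.frame D i u (Submodule.Quotient.mk ⟨A, h⟩) :=
    congrArg Submodule.Quotient.mk (Subtype.ext hA.symm)
  rw [equivariantFun, h1]
  exact Function.leftInverse_invFun (C.frame_injective hAd hD hi u) _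

/-- In every frame and for every lift `A` of `ξ`, the vector field `[ξ, η] + τ(ξ, η)` represents the
relative tractor connection applied to the class of `η`. -/
lemma bracketTorsion_tractorDeriv (hQ : ContMDiff (𝓡 nQ) (𝓡 nG) ∞ (fun q : Q => (q : G)))
    (hAd : ∀ j ≤ 0, ∀ q : Q, ∀ A ∈ D.filt j, Ad (q : G) A ∈ D.filt j)
    (hD : ∀ j ≤ 0, ∀ a : Euc nQ,
      (mfderiv (𝓡 nQ) (𝓡 nG) (fun q : Q => (q : G)) 1 a) ∈ D.filt j) {i : ℤ} (hi : i < 0)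
    (ξ : SmoothSection (C.relTangent D)) (η : SmoothSection (C.TP D i)) (u : B) (A : D.pAlg)
    (hA : C.toTangent u (A : GroupLieAlgebra (𝓡 nG) G) = ξ.toFun (C.proj u)) :
    ∃ h : C.bracketTorsion ξ.toFun η.toFun (C.proj u) ∈ C.TP D i (C.proj u),
      (Submodule.Quotient.mk ⟨_, h⟩ : C.VBundle D i (C.proj u)) =
        C.frame D i u (C.tractorDeriv D (C.project D η) u A) := by
  obtain ⟨A', hA'⟩ := C.toTangent_surjective u (η.toFun (C.proj u))
  obtain ⟨O₁, hO₁, hu₁, s, hs, hsu, hsξ⟩ := C.exists_lift ξ.contMDiff hA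
  obtain ⟨O₂, hO₂, hu₂, t, ht, -, htη⟩ := C.exists_lift η.contMDiff hA'
  have hO := hO₁.inter hO₂
  have hu : u ∈ O₁ ∩ O₂ := ⟨hu₁, hu₂⟩
  have heq := C.bracketTorsion_eq hQ ξ.contMDiff η.contMDiff hO
    (hs.mono (Set.inter_subset_left (s := O₁) (t := O₂)))
    (ht.mono (Set.inter_subset_right (s := O₁) (t := O₂)))
    (fun v hv => hsξ v hv.1) (fun v hv => htη v hv.2) hu
  have hs' := (hs.contMDiffAt (hO₁.mem_nhds hu₁)).mdifferentiableAt (by simp)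
  have ht' := (ht.contMDiffAt (hO₂.mem_nhds hu₂)).mdifferentiableAt (by simp)
  have hsp : ∀ v ∈ O₁, s v ∈ D.filt 0 := by
    intro v hv
    refine (C.toTangent_mem_iff (hAd 0 le_rfl) (hD 0 le_rfl) (u := v)).1 ?_
    rw [hsξ v hv, D.filt_zero]
    exact ξ.mem _
  have htf := fun v hv => C.equivariantFun_project hAd hD hi η (htη v hv)
  have hds : ∀ X, algDeriv G s u X ∈ D.filt 0 :=
    algDeriv_mem hs' (Filter.eventually_of_mem (hO₁.mem_nhds hu₁) hsp)
  have hdt : ∀ X, algDeriv G t u X ∈ D.filt i :=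
    algDeriv_mem ht' (Filter.eventually_of_mem (hO₂.mem_nhds hu₂) fun v hv => (htf v hv).1)
  obtain ⟨htu, htu'⟩ := htf u hu₂
  let T : GroupLieAlgebra (𝓡 nG) G := t u
  have hbr : ⁅(A : GroupLieAlgebra (𝓡 nG) G), T⁆ ∈ D.filt i :=
    D.lie_pAlg_filt A.2 htu
  set X := (C.form u).symm (A : GroupLieAlgebra (𝓡 nG) G) with hX
  have hX' : C.field s u = X := congrArg (fun w : Euc nG => (C.form u).symm w) hsu
  have hr : C.bracketFun s t u = (algDeriv G t u X +
      ⁅(A : GroupLieAlgebra (𝓡 nG) G), T⁆) -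
      algDeriv G s u (C.field t u) := by
    rw [bracketFun, hX', hsu]
    exact sub_add_eq_add_sub _ _ _
  have hmem : algDeriv G t u X +
      ⁅(A : GroupLieAlgebra (𝓡 nG) G), T⁆ ∈ D.filt i :=
    (D.filt i).add_mem (hdt X) hbr
  have h1 : C.tractorDeriv D (C.project D η) u A = Submodule.Quotient.mk ⟨_, hmem⟩ := by
    rw [tractorDeriv, htu', dirDeriv_mk ht' (Filter.eventually_of_mem (hO₂.mem_nhds hu₂) htf) X
      (hdt X)]
    rfl
  have hds' := D.filt_anti (show i + 1 ≤ 0 by omega) (hds (C.field t u))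
  rw [heq, hr, map_sub]
  have hle := D.filt_anti (show i ≤ i + 1 by omega)
  refine ⟨Submodule.sub_mem _ (C.toTangent_mem _ u hmem) (C.toTangent_mem _ u (hle hds')), ?_⟩
  rw [h1]
  refine (Submodule.Quotient.eq _).2 ?_
  have h2 := Submodule.neg_mem _ (C.toTangent_mem _ u hds')
  refine (congrArg (· ∈ C.subbundle (D.filt (i + 1)) (C.proj u)) ?_).mp h2
  exact (sub_sub_cancel_left _ _).symm

/-- The theorem, for a filtration which is invariant under the structure group and whose
components of nonpositive degree contain its Lie algebra. -/
theorem exists_bracketTorsion_section (hQ : ContMDiff (𝓡 nQ) (𝓡 nG) ∞ (fun q : Q => (q : G)))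
    (hAd : ∀ j ≤ 0, ∀ q : Q, ∀ A ∈ D.filt j, Ad (q : G) A ∈ D.filt j)
    (hD : ∀ j ≤ 0, ∀ a : Euc nQ,
      (mfderiv (𝓡 nQ) (𝓡 nG) (fun q : Q => (q : G)) 1 a) ∈ D.filt j) {i : ℤ} (hi : i < 0)
    (ξ : SmoothSection (C.relTangent D)) :
    ∃ β : SmoothSection (C.TP D i) → SmoothSection (C.TP D i),
      (∀ η x, (β η).toFun x = C.bracketTorsion ξ.toFun η.toFun x) ∧
      (∀ η₁ η₂, C.project D η₁ = C.project D η₂ → C.project D (β η₁) = C.project D (β η₂)) ∧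
      ∀ (σ : ∀ x, C.VBundle D i x) (η : SmoothSection (C.TP D i)), C.project D η = σ →
        C.project D (β η) = C.relTractorConnection D ξ.toFun σ ∧
        ∀ (u : B) (A : D.pAlg),
          C.toTangent u (A : GroupLieAlgebra (𝓡 nG) G) = ξ.toFun (C.proj u) →
          C.project D (β η) (C.proj u) = C.frame D i u (C.tractorDeriv D σ u A) := by
  have hAd0 : ∀ q : Q, ∀ A ∈ D.pAlg, Ad (q : G) A ∈ D.pAlg := by
    intro q
    rw [← D.filt_zero]
    exact hAd 0 le_rfl q
  have hmem : ∀ (η : SmoothSection (C.TP D i)) x,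
      C.bracketTorsion ξ.toFun η.toFun x ∈ C.TP D i x := by
    intro η x
    obtain ⟨u, rfl⟩ := C.proj_surjective x
    obtain ⟨A, hA, hAξ⟩ := C.exists_of_mem_subbundle hAd0 (ξ.mem (C.proj u))
    exact (C.bracketTorsion_tractorDeriv hQ hAd hD hi ξ η u ⟨A, hA⟩ hAξ).1
  let β : SmoothSection (C.TP D i) → SmoothSection (C.TP D i) := fun η =>
    ⟨C.bracketTorsion ξ.toFun η.toFun, C.contMDiff_bracketTorsion hQ ξ.contMDiff η.contMDiff, hmem η⟩
  have hβ : ∀ (η : SmoothSection (C.TP D i)) (u : B) (A : D.pAlg),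
      C.toTangent u (A : GroupLieAlgebra (𝓡 nG) G) = ξ.toFun (C.proj u) →
      C.project D (β η) (C.proj u) = C.frame D i u (C.tractorDeriv D (C.project D η) u A) :=
    fun η u A hA => (C.bracketTorsion_tractorDeriv hQ hAd hD hi ξ η u A hA).2
  have hβ' : ∀ η, C.project D (β η) = C.relTractorConnection D ξ.toFun (C.project D η) :=
    fun η => C.frame_relTractorConnection ξ.mem hAd0 (hβ η)
  refine ⟨β, fun η x => rfl, fun η₁ η₂ h => ?_, ?_⟩
  · rw [hβ' η₁, hβ' η₂, h]
  · rintro _ η rfl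
    exact ⟨hβ' η, hβ η⟩

end Tractor
end CartanGeometry
end
end RelativeTractor

theorem theorem3p2p1 {nG nQ nM nB : ℕ}
    {G : Type*} [TopologicalSpace G] [ChartedSpace (EuclideanSpace ℝ (Fin nG)) G] [Group G]
    [LieGroup (𝓡 nG) ∞ G] [LieAlgebra.IsSemisimple ℝ (GroupLieAlgebra (𝓡 nG) G)]
    (D : NestedParabolicData (GroupLieAlgebra (𝓡 nG) G))
    (P : Subgroup G) (hP : IsParabolicSubgroup D P)
    (Q : Subgroup G) [ChartedSpace (EuclideanSpace ℝ (Fin nQ)) Q] [LieGroup (𝓡 nQ) ∞ Q]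
    (hQ : IsNestedParabolicSubgroup (nQ := nQ) D P Q)
    {M : Type*} [TopologicalSpace M] [ChartedSpace (EuclideanSpace ℝ (Fin nM)) M]
    [IsManifold (𝓡 nM) ∞ M]
    {B : Type*} [TopologicalSpace B] [ChartedSpace (EuclideanSpace ℝ (Fin nB)) B]
    [IsManifold (𝓡 nB) ∞ B]
    (C : CartanGeometry (nG := nG) (nQ := nQ) (nM := nM) (nB := nB) Q M B)
    (i : ℤ) (hi : i < 0)
    (ξ : CartanGeometry.SmoothSection (C.relTangent D)) :
    -- `[ξ, η] + τ(ξ, η)` is a smooth section of `T^{i'}_P M`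
    ∃ β : CartanGeometry.SmoothSection (C.TP D i) → CartanGeometry.SmoothSection (C.TP D i),
      (∀ η x, (β η).toFun x = C.bracketTorsion ξ.toFun η.toFun x) ∧
      -- its projection depends only on the section of `V_{i'} M` represented by `η`
      (∀ η₁ η₂, C.project D η₁ = C.project D η₂ → C.project D (β η₁) = C.project D (β η₂)) ∧
      ∀ (σ : ∀ x, C.VBundle D i x) (η : CartanGeometry.SmoothSection (C.TP D i)),
        C.project D η = σ →
        -- the projection is the relative tractor connection
        C.project D (β η) = C.relTractorConnection D ξ.toFun σ ∧
        -- which can be computed in every frame and with every lift of `ξ` to `𝔭`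
        ∀ (u : B) (A : D.pAlg),
          C.toTangent u (A : GroupLieAlgebra (𝓡 nG) G) = ξ.toFun (C.proj u) →
          C.project D (β η) (C.proj u) = C.frame D i u (C.tractorDeriv D σ u A) := by
  refine C.exists_bracketTorsion_section hQ.contMDiff_coe (fun j hj q A hA => ?_)
    (fun j hj a => D.qAlg_le_filt hj ?_) hi ξ
  · refine D.map_filt (AdEquiv (q : G)) (fun X hX => ?_) hj hA
    have h := hP.2 (hQ.subset_normalizer q.2).2
    exact h ▸ Submodule.mem_map_of_mem hX
  · have h := Set.mem_range_self (f := mfderiv (𝓡 nQ) (𝓡 nG) (fun q : Q => (q : G)) 1) a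
    rw [hQ.range_eq] at h
    exact h
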